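/- Let $K$ be a compact Hausdorff space that is Gruenhage, i.e. there are families $\mathscr{U}_n$, $n\in\omega$, of open subsets of $K$ such that for all distinct $x,y\in K$ there is $n\in\omega$ for which some $U\in\mathscr{U}_n$ contains exactly one of $x,y$, and at least one of the sets $\{U\in\mathscr{U}_n : x\in U\}$, $\{U\in\mathscr{U}_n : y\in U\}$ is finite. Let $C(K)$ be the real Banach space of continuous functions on $K$ with the supremum norm, and identify $C(K)^*$, by the Riesz representation theorem, with the space of signed Radon measures on $K$ with the total variation norm $\|\cdot\|_1$. Then $C(K)^*$ admits a norm $\|\cdot\|$ that is - equivalent to $\|\cdot\|_1$; - a dual norm: there is an equivalent norm on $C(K)$ whose dual norm is $\|\cdot\|$; - a lattice norm: $\|\mu\|\le\|\nu\|$ whenever $|\mu|\le|\nu|$; - strictly convex: $\mu=\nu$ whenever $\|\mu\|=\|\nu\|=\|\tfrac12(\mu+\nu)\|$. Moreover, such a norm can be chosen of the form $$\|\mu\|^2=\|\mu\|_1^2+\sum_{m,n\in\omega}2^{-m-n}\|\mu\|_{m,n}^2 ,\qquad \|\mu\|_{m,n}=\sup\Big\{|\mu|\Big(R_n\cup\bigcup\mathscr{F}\Big)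 : \mathscr{F}\subseteq\mathscr{V}_n,\ \operatorname{card}\mathscr{F}\le m\Big\},$$ where the $\|\cdot\|_{m,n}$ are $w^*$-lower semicontinuous seminorms on $C(K)^*$, the $R_n\subseteq K$ are open sets and the $\mathscr{V}_n$ are families of open subsets of $K$ such that $R_n\subseteq V$ for all $V\in\mathscr{V}_n$, $V\cap W=R_n$ for all distinct $V,W\in\mathscr{V}_n$, and for all distinct $x,y\in K$ some member of $\bigcup_n\mathscr{V}_n$ contains exactly one of $x,y$. -/

import Mathlib

open MeasureTheory

/-- A topological space is *Gruenhage* if it has a separating family of open sets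
`𝒰 = ⋃ₙ 𝒰ₙ` that is σ-distributively point finite: for distinct `x, y` there is `n` such that
some `u ∈ 𝒰ₙ` contains exactly one of `x, y`, and `x` or `y` belongs to only finitely many
members of (the same) `𝒰ₙ`. -/
def IsGruenhage (X : Type*) [TopologicalSpace X] : Prop :=
  ∃ U : ℕ → Set (Set X),
    (∀ n, ∀ u ∈ U n, IsOpen u) ∧
    ∀ x y : X, x ≠ y → ∃ n,
      (∃ u ∈ U n, (x ∈ u ∧ y ∉ u) ∨ (x ∉ u ∧ y ∈ u)) ∧
      ({u | u ∈ U n ∧ x ∈ u}.Finite ∨ {u | u ∈ U n ∧ y ∈ u}.Finite)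

/-- Open sets `Rₙ` and families `𝒰ₙ` of open sets such that `Rₙ ⊆ u` for `u ∈ 𝒰ₙ`, any two
distinct members of `𝒰ₙ` meet exactly in `Rₙ`, and `⋃ₙ 𝒰ₙ` separates points. -/
structure IsGruenhageSystem {X : Type*} [TopologicalSpace X]
    (R : ℕ → Set X) (U : ℕ → Set (Set X)) : Prop where
  isOpen_core : ∀ n, IsOpen (R n)
  isOpen_mem : ∀ n, ∀ u ∈ U n, IsOpen u
  core_subset : ∀ n, ∀ u ∈ U n, R n ⊆ u
  inter_eq : ∀ n, ∀ u ∈ U n, ∀ v ∈ U n, u ≠ v → u ∩ v = R n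
  separates : ∀ x y : X, x ≠ y → ∃ n, ∃ u ∈ U n, (x ∈ u ∧ y ∉ u) ∨ (x ∉ u ∧ y ∈ u)

/-- The norm `N` on the normed space `E` is equivalent to the given one. (The lower bound makes
the seminorm `N` a norm.) -/
def IsEquivalentNorm {E : Type*} [NormedAddCommGroup E] [NormedSpace ℝ E]
    (N : Seminorm ℝ E) : Prop :=
  ∃ c C : ℝ, 0 < c ∧ 0 < C ∧ ∀ x, c * ‖x‖ ≤ N x ∧ N x ≤ C * ‖x‖

/-- `N` is a *dual norm* on `E*`: it is the dual norm of some equivalent norm `p` on `E`. -/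
def IsDualNorm {E : Type*} [NormedAddCommGroup E] [NormedSpace ℝ E]
    (N : Seminorm ℝ (StrongDual ℝ E)) : Prop :=
  ∃ p : Seminorm ℝ E, IsEquivalentNorm p ∧
    ∀ φ : StrongDual ℝ E, IsLUB {r : ℝ | ∃ x : E, p x ≤ 1 ∧ r = φ x} (N φ)

/-- `N` is strictly convex. -/
def IsStrictlyConvexNorm {E : Type*} [AddCommGroup E] [Module ℝ E] (N : Seminorm ℝ E) : Prop :=
  ∀ x y : E, N x = N y → N y = N ((1 / 2 : ℝ) • (x + y)) → x = y

/-- A real function on the dual space `E*` is weak-* lower semicontinuous. -/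
def IsWeakStarLSC {E : Type*} [NormedAddCommGroup E] [NormedSpace ℝ E]
    (F : StrongDual ℝ E → ℝ) : Prop :=
  LowerSemicontinuous fun φ : WeakDual ℝ E => F (WeakDual.toStrongDual φ)

section RadonMeasures

variable {K : Type*} [TopologicalSpace K] [CompactSpace K] [MeasurableSpace K] [BorelSpace K]

/-- The signed Radon measure `μ` represents the functional `φ ∈ C(K)*`, i.e. `φ f = ∫ f dμ` for
all `f ∈ C(K)`, where `∫ f dμ = ∫ f dμ⁺ - ∫ f dμ⁻`. For `K` compact Hausdorff this is the Riesz
identification of `C(K)*` with the space of signed Radon measures on `K`: every `φ` is represented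
by exactly one `μ` and every `μ` represents exactly one `φ`. -/
def RepresentedBy (φ : StrongDual ℝ C(K, ℝ)) (μ : SignedMeasure K) : Prop :=
  μ.totalVariation.Regular ∧
  ∀ f : C(K, ℝ), φ f = ∫ x, f x ∂μ.toJordanDecomposition.posPart -
    ∫ x, f x ∂μ.toJordanDecomposition.negPart

/-- `N` is a *lattice norm* on `C(K)*`: `N μ ≤ N ν` whenever `|μ| ≤ |ν|`. -/
def IsLatticeNorm (N : Seminorm ℝ (StrongDual ℝ C(K, ℝ))) : Prop :=
  ∀ (φ ψ : StrongDual ℝ C(K, ℝ)) (μ ν : SignedMeasure K),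
    RepresentedBy φ μ → RepresentedBy ψ ν → μ.totalVariation ≤ ν.totalVariation → N φ ≤ N ψ

/-- `S` is the seminorm `μ ↦ sup {|μ|(R ∪ ⋃ 𝓕) : 𝓕 ⊆ 𝒰, card 𝓕 ≤ m}` on `C(K)*`. -/
def IsSupSeminorm (R : Set K) (U : Set (Set K)) (m : ℕ)
    (S : Seminorm ℝ (StrongDual ℝ C(K, ℝ))) : Prop :=
  ∀ (φ : StrongDual ℝ C(K, ℝ)) (μ : SignedMeasure K), RepresentedBy φ μ →
    IsLUB {r : ℝ | ∃ F : Finset (Set K), (F : Set (Set K)) ⊆ U ∧ F.card ≤ m ∧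
      r = μ.totalVariation.real (R ∪ ⋃₀ (F : Set (Set K)))} (S φ)

end RadonMeasures

/-! The norm is a weighted `ℓ²`-sum of seminorms, each a supremum of evaluations over a subset of
the unit ball of `C(K)`. Cauchy–Schwarz on finite partial sums shows that the sum is again a
supremum of evaluations, hence a dual norm. As the variation of an open set is the supremum over
functions supported in it (`RepresentedBy.isLUB_isOpen`), the seminorms are the prescribed ones and
depend monotonically on `|μ|`.

For strict convexity, equality at the midpoint forces every summand to be equal at `μ`, `ν` and
additive on the pair (`eq_of_ellTwoSeminorm_eq`). The summand `‖·‖₁` gives `|μ + ν| = |μ| + |ν|`.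
Off the core the members of one family are disjoint, so the other seminorms are sums of largest
values; comparing the top sums with and without `V` gives `|μ|(V \ Rₙ) = |ν|(V \ Rₙ)`
(`IsCoreFamily.measureReal_sdiff_eq`).

The system is built from points counted by multiplicity and closed under common refinement, so the
sets `V \ Rₙ` form a π-system and `|μ|`, `|ν|` agree on the σ-algebra it generates. Only countably
many of these sets are not null, so off a null set countably many open sets of that σ-algebra
separate points; on large compact sets they define a continuous injection into a Cantor cube, whence
`|μ| = |ν|` (`eq_of_system`). Hahn decompositions then give `μ = ν`. -/

/-! ### Suprema of evaluations on a dual space. -/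

section SupSeminorm

variable {E : Type*} [NormedAddCommGroup E] [NormedSpace ℝ E]

/-- The seminorm `φ ↦ sup {|φ x| : x ∈ B}` on the dual space. -/
noncomputable def supSeminorm (B : Set E) : Seminorm ℝ (StrongDual ℝ E) :=
  ⨆ x : B, (normSeminorm ℝ ℝ).comp (ContinuousLinearMap.apply ℝ ℝ (x : E)).toLinearMap

theorem supSeminorm_bddAbove {B : Set E} (hB : B ⊆ Metric.closedBall 0 1) (φ : StrongDual ℝ E) :
    BddAbove (Set.range fun x : B => |φ x|) := by
  refine ⟨‖φ‖, ?_⟩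
  rintro _ ⟨x, rfl⟩
  exact φ.unit_le_opNorm x (by simpa using hB x.2)

theorem supSeminorm_apply {B : Set E} (hB : B ⊆ Metric.closedBall 0 1) (φ : StrongDual ℝ E) :
    supSeminorm B φ = ⨆ x : B, |φ x| := by
  unfold supSeminorm
  rw [Seminorm.iSup_apply]
  · rfl
  · refine ⟨normSeminorm ℝ _, ?_⟩
    rintro _ ⟨x, rfl⟩ φ
    exact φ.unit_le_opNorm x (by simpa using hB x.2)

theorem abs_le_supSeminorm {B : Set E} (hB : B ⊆ Metric.closedBall 0 1) (φ : StrongDual ℝ E)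
    {x : E} (hx : x ∈ B) : |φ x| ≤ supSeminorm B φ := by
  rw [supSeminorm_apply hB]
  exact le_ciSup (supSeminorm_bddAbove hB φ) ⟨x, hx⟩

theorem supSeminorm_le_norm {B : Set E} (hB : B ⊆ Metric.closedBall 0 1) (φ : StrongDual ℝ E) :
    supSeminorm B φ ≤ ‖φ‖ := by
  rw [supSeminorm_apply hB]
  exact Real.iSup_le (fun x => φ.unit_le_opNorm x (by simpa using hB x.2)) (norm_nonneg _)

/-- Symmetry of `B` removes the absolute value. Having `0 ∈ B` excludes the empty set, over which
the real supremum takes the default value `0`. -/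
theorem isLUB_supSeminorm {B : Set E} (hB : B ⊆ Metric.closedBall 0 1)
    (hneg : ∀ x ∈ B, -x ∈ B) (h0 : 0 ∈ B) (φ : StrongDual ℝ E) :
    IsLUB (φ '' B) (supSeminorm B φ) := by
  constructor
  · rintro _ ⟨x, hx, rfl⟩
    exact (le_abs_self _).trans (abs_le_supSeminorm hB φ hx)
  · intro b hb
    rw [supSeminorm_apply hB]
    refine Real.iSup_le (fun x => abs_le.2 ⟨?_, hb ⟨x, x.2, rfl⟩⟩) ?_
    · have := hb ⟨-x, hneg x x.2, rfl⟩
      rw [map_neg] at this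
      linarith
    · simpa using hb ⟨0, h0, rfl⟩

theorem isWeakStarLSC_supSeminorm {B : Set E} (hB : B ⊆ Metric.closedBall 0 1) :
    IsWeakStarLSC (supSeminorm B : StrongDual ℝ E → ℝ) := by
  unfold IsWeakStarLSC
  simp_rw [supSeminorm_apply hB]
  refine lowerSemicontinuous_ciSup (fun φ => supSeminorm_bddAbove hB _) fun x => ?_
  exact (WeakDual.eval_continuous (𝕜 := ℝ) (x : E)).abs.lowerSemicontinuous

theorem supSeminorm_closedBall (φ : StrongDual ℝ E) :
    supSeminorm (Metric.closedBall (0 : E) 1) φ = ‖φ‖ := by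
  refine le_antisymm (supSeminorm_le_norm subset_rfl φ) ?_
  refine φ.opNorm_le_of_unit_norm (apply_nonneg _ _) fun x hx => ?_
  exact abs_le_supSeminorm subset_rfl φ (by simp [hx])

end SupSeminorm

/-! ### Dual norms from suprema of evaluations. -/

section DualNorm

variable {E : Type*} [NormedAddCommGroup E] [NormedSpace ℝ E]

/-- An equivalent norm on the dual space which is a supremum of evaluations is a dual norm. -/
theorem isDualNorm_of_exists_lt {N : Seminorm ℝ (StrongDual ℝ E)}
    (hN : IsEquivalentNorm (E := StrongDual ℝ E) N)
    (h : ∀ (φ : StrongDual ℝ E) (r : ℝ), 0 ≤ r → r < N φ →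
      ∃ x : E, (∀ ψ : StrongDual ℝ E, ψ x ≤ N ψ) ∧ r < φ x) : IsDualNorm N := by
  obtain ⟨c, C, hc, hC, hcC⟩ := hN
  have bound (φ : {φ : StrongDual ℝ E // N φ ≤ 1}) (x : E) :
      |(φ : StrongDual ℝ E) x| ≤ c⁻¹ * ‖x‖ := by
    refine ((φ : StrongDual ℝ E).le_opNorm x).trans ?_
    gcongr
    rw [← one_div, le_div_iff₀' hc]
    exact (hcC φ).1.trans φ.2
  have bdd (x : E) : BddAbove (Set.range fun φ : {φ : StrongDual ℝ E // N φ ≤ 1} =>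
      |(φ : StrongDual ℝ E) x|) := by
    refine ⟨c⁻¹ * ‖x‖, ?_⟩
    rintro _ ⟨φ, rfl⟩
    exact bound φ x
  -- The predual norm is the support function of the `N`-unit ball.
  let p : Seminorm ℝ E := ⨆ φ : {φ : StrongDual ℝ E // N φ ≤ 1},
    (normSeminorm ℝ ℝ).comp (φ : StrongDual ℝ E).toLinearMap
  have hp (x : E) : p x = ⨆ φ : {φ : StrongDual ℝ E // N φ ≤ 1}, |(φ : StrongDual ℝ E) x| := by
    refine (Seminorm.iSup_apply ?_).trans rfl
    rw [Seminorm.bddAbove_iff]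
    refine ⟨fun x => c⁻¹ * ‖x‖, ?_⟩
    rintro _ ⟨_, ⟨φ, rfl⟩, rfl⟩ x
    exact bound φ x
  have hp_le (φ : StrongDual ℝ E) (hφ : N φ ≤ 1) (x : E) : |φ x| ≤ p x := by
    rw [hp]
    exact le_ciSup (bdd x) ⟨φ, hφ⟩
  refine ⟨p, ⟨C⁻¹, c⁻¹, by positivity, by positivity, fun x => ⟨?_, ?_⟩⟩, fun φ => ⟨?_, ?_⟩⟩
  · obtain ⟨g, hg, hgx⟩ := exists_dual_vector'' ℝ x
    -- Scaling a norming functional by `C⁻¹` brings it into the `N`-unit ball.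
    have hle : N (C⁻¹ • g) ≤ 1 := by
      refine (hcC _).2.trans ?_
      rw [norm_smul, Real.norm_of_nonneg (by positivity), mul_inv_cancel_left₀ hC.ne']
      exact hg
    have := hp_le _ hle x
    rw [smul_apply, hgx] at this
    refine (le_abs_self _).trans ?_
    simpa using this
  · rw [hp]
    exact Real.iSup_le (fun φ => bound φ x) (by positivity)
  · rintro _ ⟨x, hx, rfl⟩
    rcases (apply_nonneg N φ).eq_or_lt with h0 | h0
    · have := (hcC φ).1
      have hφ : ‖φ‖ ≤ 0 := by
        by_contra! hcon
        nlinarith [mul_pos hc hcon]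
      have : φ = 0 := norm_le_zero_iff.1 hφ
      simp [this]
    · have hle : N ((N φ)⁻¹ • φ) ≤ 1 := by
        rw [map_smul_eq_mul, Real.norm_of_nonneg (by positivity), inv_mul_cancel₀ h0.ne']
      have := (le_abs_self _).trans ((hp_le _ hle x).trans hx)
      rw [smul_apply, smul_eq_mul, inv_mul_le_iff₀ h0, mul_one] at this
      exact this
  · intro b hb
    have hb0 : 0 ≤ b := hb ⟨0, by simp, by simp⟩
    by_contra! hlt
    -- Being dominated by `N`, evaluation at `x` is at most `1` on the `N`-ball, so `p x ≤ 1`; this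
    -- replaces the bipolar theorem.
    obtain ⟨x, hx, hbx⟩ := h φ b hb0 hlt
    refine hbx.not_ge (hb ⟨x, ?_, rfl⟩)
    rw [hp]
    refine Real.iSup_le (fun ψ => abs_le.2 ⟨?_, (hx ψ).trans ψ.2⟩) zero_le_one
    have h1 := hx (-ψ)
    have h2 := ψ.2
    rw [map_neg_eq_map] at h1
    simp only [neg_apply] at h1
    linarith

end DualNorm

/-! ### Weighted `ℓ²`-sums of seminorms and their convexity. -/

section EllTwo

variable {ι F : Type*} [AddCommGroup F] [Module ℝ F]

/-- The weighted `ℓ²`-sum of a family of seminorms. -/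
noncomputable def ellTwoSeminorm (w : ι → ℝ) (q : ι → Seminorm ℝ F) (hw : ∀ i, 0 ≤ w i)
    (hs : ∀ x, Summable fun i => w i * q i x ^ 2) : Seminorm ℝ F :=
  Seminorm.of (fun x => √(∑' i, w i * q i x ^ 2))
    (fun x y => by
      have key (x : F) (i : ι) : (√(w i) * q i x) ^ (2 : ℝ) = w i * q i x ^ 2 := by
        rw [Real.rpow_two, mul_pow, Real.sq_sqrt (hw i)]
      have h0 (x : F) (i : ι) : 0 ≤ √(w i) * q i x := by positivity
      have := Real.Lp_add_le_tsum_of_nonneg one_le_two (h0 x) (h0 y)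
        (by simpa only [key] using hs x) (by simpa only [key] using hs y)
      simp only [key, ← Real.sqrt_eq_rpow] at this
      refine le_trans (Real.sqrt_le_sqrt ?_) this.2
      refine (hs (x + y)).tsum_le_tsum (fun i => ?_) this.1
      rw [← key]
      refine Real.rpow_le_rpow (h0 _ i) ?_ zero_le_two
      rw [← mul_add]
      exact mul_le_mul_of_nonneg_left (map_add_le_add _ _ _) (Real.sqrt_nonneg _))
    (fun a x => by
      simp_rw [map_smul_eq_mul, mul_pow, mul_left_comm _ (‖a‖ ^ 2)]
      rw [tsum_mul_left, Real.sqrt_mul (by positivity), Real.sqrt_sq (norm_nonneg _)])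

variable {w : ι → ℝ} {q : ι → Seminorm ℝ F} {hw : ∀ i, 0 ≤ w i}
  {hs : ∀ x, Summable fun i => w i * q i x ^ 2}

theorem ellTwoSeminorm_sq (x : F) :
    ellTwoSeminorm w q hw hs x ^ 2 = ∑' i, w i * q i x ^ 2 :=
  Real.sq_sqrt (tsum_nonneg fun i => mul_nonneg (hw i) (sq_nonneg _))

theorem ellTwoSeminorm_mono {x y : F} (h : ∀ i, q i x ≤ q i y) :
    ellTwoSeminorm w q hw hs x ≤ ellTwoSeminorm w q hw hs y :=
  Real.sqrt_le_sqrt ((hs x).tsum_le_tsum (fun i => mul_le_mul_of_nonneg_left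
    (pow_le_pow_left₀ (apply_nonneg _ _) (h i) 2) (hw i)) (hs y))

/-- If `x`, `y` and their midpoint have the same `ℓ²`-seminorm then they have the same seminorms. -/
theorem eq_of_ellTwoSeminorm_eq {x y : F}
    (h₁ : ellTwoSeminorm w q hw hs x = ellTwoSeminorm w q hw hs y)
    (h₂ : ellTwoSeminorm w q hw hs y = ellTwoSeminorm w q hw hs ((1 / 2 : ℝ) • (x + y)))
    {i : ι} (hi : 0 < w i) : q i x = q i y ∧ q i (x + y) = q i x + q i y := by
  have hmid (j : ι) : q j ((1 / 2 : ℝ) • (x + y)) = q j (x + y) / 2 := by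
    rw [map_smul_eq_mul, Real.norm_of_nonneg (by norm_num)]
    ring
  -- This deficit is at least `((q j x - q j y) / 2) ^ 2`. The weighted deficits sum to zero, so
  -- each one with positive weight vanishes, which forces both equality and additivity.
  have hd (j : ι) : 0 ≤ (q j x ^ 2 + q j y ^ 2) / 2 - (q j (x + y) / 2) ^ 2 := by
    have h1 := map_add_le_add (q j) x y
    have h2 := apply_nonneg (q j) (x + y)
    nlinarith [sq_nonneg (q j x - q j y)]
  have hsum : HasSum (fun j => w j * ((q j x ^ 2 + q j y ^ 2) / 2 - (q j (x + y) / 2) ^ 2)) 0 := by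
    have hx := (hs x).hasSum
    have hy := (hs y).hasSum
    have hz := (hs ((1 / 2 : ℝ) • (x + y))).hasSum
    rw [← ellTwoSeminorm_sq (hw := hw) (hs := hs)] at hx hy hz
    rw [h₁, h₂] at hx
    rw [h₂] at hy
    have := ((hx.add hy).div_const 2).sub hz
    simp only [hmid, add_self_div_two, sub_self] at this
    have e (j : ι) : w j * ((q j x ^ 2 + q j y ^ 2) / 2 - (q j (x + y) / 2) ^ 2) =
        (w j * q j x ^ 2 + w j * q j y ^ 2) / 2 - w j * (q j (x + y) / 2) ^ 2 := by ring
    simpa only [e] using this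
  have hz := (hasSum_zero_iff_of_nonneg fun j => mul_nonneg (hw j) (hd j)).1 hsum
  have hzi : w i * ((q i x ^ 2 + q i y ^ 2) / 2 - (q i (x + y) / 2) ^ 2) = 0 := congrFun hz i
  have hzi' := (mul_eq_zero.1 hzi).resolve_left hi.ne'
  have h1 := map_add_le_add (q i) x y
  have h2 := apply_nonneg (q i) (x + y)
  have h3 := apply_nonneg (q i) x
  have h4 := apply_nonneg (q i) y
  have hxy : q i x = q i y := by
    have : (q i x - q i y) ^ 2 ≤ 0 := by nlinarith
    nlinarith [pow_eq_zero_iff (two_ne_zero) |>.1 (le_antisymm this (sq_nonneg _))]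
  refine ⟨hxy, le_antisymm h1 ?_⟩
  rw [hxy] at hzi' ⊢
  nlinarith

end EllTwo

/-! ### Duality for `ℓ²`-sums. -/

section EllTwoDual

variable {ι E : Type*} [NormedAddCommGroup E] [NormedSpace ℝ E]

/-- An `ℓ²`-sum of suprema of evaluations is itself a supremum of evaluations. -/
theorem exists_lt_of_lt_ellTwoSeminorm {w : ι → ℝ} {q : ι → Seminorm ℝ (StrongDual ℝ E)}
    {hw : ∀ i, 0 ≤ w i} {hs : ∀ x, Summable fun i => w i * q i x ^ 2} {B : ι → Set E}
    (hB : ∀ i φ, IsLUB ((φ : StrongDual ℝ E) '' B i) (q i φ))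
    (φ : StrongDual ℝ E) (r : ℝ) (hr : 0 ≤ r) (hlt : r < ellTwoSeminorm w q hw hs φ) :
    ∃ x : E, (∀ ψ : StrongDual ℝ E, ψ x ≤ ellTwoSeminorm w q hw hs ψ) ∧ r < φ x := by
  set N := ellTwoSeminorm w q hw hs with hN
  have hpos : 0 < N φ := hr.trans_lt hlt
  have hrN : r * N φ < ∑' i, w i * q i φ ^ 2 := by
    rw [← ellTwoSeminorm_sq (hw := hw) (hs := hs), ← hN]
    nlinarith
  obtain ⟨s, hsum⟩ := ((hs φ).hasSum.eventually_const_lt hrN).exists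
  have hD : 0 ≤ ∑ i ∈ s, w i * q i φ :=
    Finset.sum_nonneg fun i _ => mul_nonneg (hw i) (apply_nonneg _ _)
  set D := ∑ i ∈ s, w i * q i φ with hDdef
  set A := ∑ i ∈ s, w i * q i φ ^ 2 - r * N φ with hA
  have hApos : 0 < A := sub_pos.2 hsum
  -- Replacing each `q i φ` by a value of `φ` with this error costs at most `D * (A / (D + 1)) < A`
  -- in total; the `+ 1` covers `D = 0`.
  have hδ : 0 < A / (D + 1) := by positivity
  have hx (i : ι) : ∃ x ∈ B i, q i φ - A / (D + 1) < φ x := by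
    obtain ⟨_, ⟨x, hx, rfl⟩, h, -⟩ := (hB i φ).exists_between (sub_lt_self _ hδ)
    exact ⟨x, hx, h⟩
  choose x hxB hx using hx
  have partial_le (ψ : StrongDual ℝ E) : √(∑ i ∈ s, w i * q i ψ ^ 2) ≤ N ψ :=
    Real.sqrt_le_sqrt ((hs ψ).sum_le_tsum s fun i _ => mul_nonneg (hw i) (sq_nonneg _))
  -- The coefficients are those of equality in Cauchy–Schwarz at `φ`.
  refine ⟨(N φ)⁻¹ • ∑ i ∈ s, (w i * q i φ) • x i, fun ψ => ?_, ?_⟩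
  · rw [map_smul, map_sum, smul_eq_mul, inv_mul_le_iff₀ hpos]
    calc ∑ i ∈ s, ψ ((w i * q i φ) • x i) 
        ≤ ∑ i ∈ s, (√(w i) * q i φ) * (√(w i) * q i ψ) := by
          refine Finset.sum_le_sum fun i _ => ?_
          rw [map_smul, smul_eq_mul]
          have h1 : ψ (x i) ≤ q i ψ := (hB i ψ).1 ⟨x i, hxB i, rfl⟩
          have h2 : 0 ≤ w i * q i φ := mul_nonneg (hw i) (apply_nonneg _ _)
          calc _ ≤ w i * q i φ * q i ψ := mul_le_mul_of_nonneg_left h1 h2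
            _ = _ := by
              nth_rewrite 1 [← Real.mul_self_sqrt (hw i)]
              ring
      _ ≤ √(∑ i ∈ s, (√(w i) * q i φ) ^ 2) * √(∑ i ∈ s, (√(w i) * q i ψ) ^ 2) :=
          Real.sum_mul_le_sqrt_mul_sqrt _ _ _
      _ ≤ N φ * N ψ := by
          simp_rw [mul_pow, Real.sq_sqrt (hw _)]
          exact mul_le_mul (partial_le φ) (partial_le ψ) (Real.sqrt_nonneg _) hpos.le
  · rw [map_smul, map_sum, smul_eq_mul, lt_inv_mul_iff₀ hpos]
    calc N φ * r < ∑ i ∈ s, w i * q i φ ^ 2 - A / (D + 1) * D := by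
          have : A / (D + 1) * D < A := by
            rw [div_mul_eq_mul_div, div_lt_iff₀ (by positivity)]
            nlinarith
          rw [mul_comm]
          linarith
      _ = ∑ i ∈ s, (w i * q i φ) * (q i φ - A / (D + 1)) := by
          rw [hDdef, Finset.mul_sum, ← Finset.sum_sub_distrib]
          exact Finset.sum_congr rfl fun i _ => by ring
      _ ≤ ∑ i ∈ s, φ ((w i * q i φ) • x i) := by
          refine Finset.sum_le_sum fun i _ => ?_
          rw [map_smul, smul_eq_mul]
          exact mul_le_mul_of_nonneg_left (hx i).le (mul_nonneg (hw i) (apply_nonneg _ _))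

end EllTwoDual

/-! ### Regularity of dominated measures and of sums. -/

section Regular

variable {X : Type*} [TopologicalSpace X] [MeasurableSpace X]

/-- Smallness of the differences, unlike closeness of the measures of the sets, passes at once to
smaller measures and to sums. -/
theorem regular_of_forall_sdiff_lt {μ : Measure X} [IsFiniteMeasure μ]
    (h₁ : ∀ A, MeasurableSet A → ∀ ε : ENNReal, ε ≠ 0 → ∃ U, A ⊆ U ∧ IsOpen U ∧ μ (U \ A) < ε)
    (h₂ : ∀ U, IsOpen U → ∀ ε : ENNReal, ε ≠ 0 → ∃ K ⊆ U, IsCompact K ∧ μ (U \ K) < ε) :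
    μ.Regular := by
  have split (A B : Set X) : μ A ≤ μ B + μ (A \ B) :=
    (measure_le_inter_add_sdiff μ A B).trans (by gcongr; exact Set.inter_subset_right)
  refine { lt_top_of_isCompact := fun K _ => measure_lt_top μ K, outerRegular := ?_, innerRegular := ?_ }
  · intro A hA r hr
    obtain ⟨U, hAU, hU, hlt⟩ := h₁ A hA _ (tsub_pos_of_lt hr).ne'
    exact ⟨U, hAU, hU, (split U A).trans_lt (lt_tsub_iff_left.1 hlt)⟩
  · intro U hU r hr
    obtain ⟨K, hKU, hK, hlt⟩ := h₂ U hU _ (tsub_pos_of_lt hr).ne'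
    refine ⟨K, hKU, hK, ?_⟩
    by_contra! hcon
    exact hlt.not_ge (tsub_le_iff_left.2 ((split U K).trans (by gcongr)))

variable [T2Space X] [BorelSpace X]

theorem regular_of_le {μ ν : Measure X} [IsFiniteMeasure ν] [ν.Regular] (h : μ ≤ ν) :
    μ.Regular := by
  have : IsFiniteMeasure μ := isFiniteMeasure_of_le ν h
  refine regular_of_forall_sdiff_lt (fun A hA ε hε => ?_) fun U hU ε hε => ?_
  · obtain ⟨U, hAU, hU, -, hlt⟩ := hA.exists_isOpen_sdiff_lt (measure_ne_top ν A) hε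
    exact ⟨U, hAU, hU, (h _).trans_lt hlt⟩
  · obtain ⟨K, hKU, hK, hlt⟩ :=
      hU.measurableSet.exists_isCompact_sdiff_lt (measure_ne_top ν U) hε
    exact ⟨K, hKU, hK, (h _).trans_lt hlt⟩

theorem regular_add {μ ν : Measure X} [IsFiniteMeasure μ] [IsFiniteMeasure ν] [μ.Regular]
    [ν.Regular] : (μ + ν).Regular := by
  have add_lt {ε : ENNReal} {A B C : Set X} (hμ : μ A < ε / 2) (hν : ν B < ε / 2)
      (hA : C ⊆ A) (hB : C ⊆ B) : (μ + ν) C < ε := by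
    rw [Measure.add_apply, ← ENNReal.add_halves ε]
    exact ENNReal.add_lt_add ((measure_mono hA).trans_lt hμ) ((measure_mono hB).trans_lt hν)
  refine regular_of_forall_sdiff_lt (fun A hA ε hε => ?_) fun U hU ε hε => ?_
  · have hε' := (ENNReal.half_pos hε).ne'
    obtain ⟨U, hAU, hU, -, hlt⟩ := hA.exists_isOpen_sdiff_lt (measure_ne_top μ A) hε'
    obtain ⟨V, hAV, hV, -, hlt'⟩ := hA.exists_isOpen_sdiff_lt (measure_ne_top ν A) hε'
    exact ⟨U ∩ V, Set.subset_inter hAU hAV, hU.inter hV,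
      add_lt hlt hlt' (by grind) (by grind)⟩
  · have hε' := (ENNReal.half_pos hε).ne'
    obtain ⟨K, hKU, hK, hlt⟩ :=
      hU.measurableSet.exists_isCompact_sdiff_lt (measure_ne_top μ U) hε'
    obtain ⟨L, hLU, hL, hlt'⟩ :=
      hU.measurableSet.exists_isCompact_sdiff_lt (measure_ne_top ν U) hε'
    exact ⟨K ∪ L, Set.union_subset hKU hLU, hK.union hL, add_lt hlt hlt' (by grind) (by grind)⟩

end Regular

/-! ### Total variation and Hahn sets of signed measures. -/

section SignedMeasure

variable {X : Type*} [MeasurableSpace X]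

theorem totalVariation_add_le (μ ν : SignedMeasure X) :
    (μ + ν).totalVariation ≤ μ.totalVariation + ν.totalVariation := by
  simp only [SignedMeasure.totalVariation_eq_variation]
  exact VectorMeasure.variation_add_le

theorem totalVariation_toSignedMeasure_sub_le (p q : Measure X) [IsFiniteMeasure p]
    [IsFiniteMeasure q] : (p.toSignedMeasure - q.toSignedMeasure).totalVariation ≤ p + q := by
  rw [SignedMeasure.totalVariation_eq_variation]
  refine VectorMeasure.variation_sub_le.trans ?_
  simp

instance isFiniteMeasure_totalVariation (μ : SignedMeasure X) :
    IsFiniteMeasure μ.totalVariation := by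
  unfold SignedMeasure.totalVariation
  infer_instance

theorem posPart_le_totalVariation (μ : SignedMeasure X) :
    μ.toJordanDecomposition.posPart ≤ μ.totalVariation :=
  Measure.le_add_right le_rfl

theorem negPart_le_totalVariation (μ : SignedMeasure X) :
    μ.toJordanDecomposition.negPart ≤ μ.totalVariation :=
  Measure.le_add_left le_rfl

theorem toSignedMeasure_posPart_sub_negPart (μ : SignedMeasure X) :
    μ.toJordanDecomposition.posPart.toSignedMeasure -
      μ.toJordanDecomposition.negPart.toSignedMeasure = μ :=
  μ.toSignedMeasure_toJordanDecomposition

/-- The measures `p`, `q` need not be mutually singular, hence need not be the Jordan parts. Moving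
the subtracted terms across leaves an equality of positive measures, which can be integrated. -/
theorem posPart_add_eq_add_negPart {p q : Measure X} [IsFiniteMeasure p] [IsFiniteMeasure q]
    {μ : SignedMeasure X} (h : μ = p.toSignedMeasure - q.toSignedMeasure) :
    μ.toJordanDecomposition.posPart + q = p + μ.toJordanDecomposition.negPart := by
  rw [← Measure.toSignedMeasure_eq_toSignedMeasure_iff, Measure.toSignedMeasure_add,
    Measure.toSignedMeasure_add]
  have := (toSignedMeasure_posPart_sub_negPart μ).trans h
  rw [sub_eq_sub_iff_add_eq_add] at this
  exact this

theorem exists_hahn_set (μ : SignedMeasure X) : ∃ P, MeasurableSet P ∧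
    (∀ A ⊆ P, MeasurableSet A → μ A = μ.totalVariation.real A) ∧
    ∀ A ⊆ Pᶜ, MeasurableSet A → μ A = -μ.totalVariation.real A := by
  obtain ⟨P, hP, hp, hn⟩ := μ.toJordanDecomposition.mutuallySingular
  have hμ (A : Set X) : μ.totalVariation.real A = μ.toJordanDecomposition.posPart.real A +
    μ.toJordanDecomposition.negPart.real A := measureReal_add_apply
  -- The positive part vanishes on `P`, so the positive set is the complement.
  refine ⟨Pᶜ, hP.compl, fun A hA hAm => ?_, fun A hA hAm => ?_⟩
  · have h0 : μ.toJordanDecomposition.negPart.real A = 0 :=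
      (measureReal_eq_zero_iff).2 (measure_mono_null hA hn)
    rw [μ.apply_eq_posPart_real_sub_negPart_real hAm, hμ, h0, sub_zero, add_zero]
  · rw [compl_compl] at hA
    have h0 : μ.toJordanDecomposition.posPart.real A = 0 :=
      (measureReal_eq_zero_iff).2 (measure_mono_null hA hp)
    rw [μ.apply_eq_posPart_real_sub_negPart_real hAm, hμ, h0, zero_sub, zero_add]

theorem totalVariation_eq_zero {μ : SignedMeasure X} {D : Set X} (hD : MeasurableSet D)
    (h : ∀ A ⊆ D, MeasurableSet A → μ A = 0) : μ.totalVariation D = 0 := by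
  rw [SignedMeasure.totalVariation_eq_variation]
  have := VectorMeasure.variation_apply_le_of_forall_enorm_le (μ := μ) (m := 0) hD
    (fun A hA hAD => by simp [h A hAD hA])
  simpa using this

/-- If the variation is additive on a pair of signed measures with the same variation, then they
are equal. -/
theorem eq_of_totalVariation_add {μ ν : SignedMeasure X}
    (h : μ.totalVariation = ν.totalVariation)
    (hadd : (μ + ν).totalVariation = μ.totalVariation + ν.totalVariation) : μ = ν := by
  obtain ⟨P, hP, hPp, hPn⟩ := exists_hahn_set μ
  obtain ⟨Q, hQ, hQp, hQn⟩ := exists_hahn_set ν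
  -- Where `μ + ν` vanishes, additivity makes both variations null. This happens on `P \ Q` and `Q \
  -- P`, where the signs are opposite and the variations equal; elsewhere the signs agree.
  have null (D : Set X) (hD : MeasurableSet D) (hz : ∀ A ⊆ D, MeasurableSet A → (μ + ν) A = 0) :
      ∀ A ⊆ D, μ A = ν A := by
    intro A hA
    have h0 := totalVariation_eq_zero hD hz
    rw [hadd, Measure.add_apply, add_eq_zero] at h0
    rw [μ.null_of_totalVariation_zero (measure_mono_null hA h0.1),
      ν.null_of_totalVariation_zero (measure_mono_null hA h0.2)]
  ext A hA
  have split (ρ : SignedMeasure X) : ρ A = (ρ ((A ∩ P) ∩ Q) + ρ ((A ∩ P) \ Q)) +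
      (ρ ((A \ P) ∩ Q) + ρ ((A \ P) \ Q)) := by
    have key {B C : Set X} (hB : MeasurableSet B) (hC : MeasurableSet C) :
        ρ (B ∩ C) + ρ (B \ C) = ρ B := by
      rw [← VectorMeasure.of_union (by grind) (hB.inter hC) (hB.diff hC),
        Set.inter_union_sdiff]
    rw [key (hA.inter hP) hQ, key (hA.diff hP) hQ, key hA hP]
  rw [split μ, split ν]
  congr 2
  · rw [hPp _ (by grind) (by measurability), hQp _ (by grind) (by measurability), h]
  · refine null (P \ Q) (hP.diff hQ) (fun B hB hBm => ?_) _ (by grind)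
    rw [add_apply, hPp B (by grind) hBm, hQn B (by grind) hBm, h, add_neg_cancel]
  · refine null (Q \ P) (hQ.diff hP) (fun B hB hBm => ?_) _ (by grind)
    rw [add_apply, hPn B (by grind) hBm, hQp B (by grind) hBm, h, neg_add_cancel]
  · rw [hPn _ (by grind) (by measurability), hQn _ (by grind) (by measurability), h]

end SignedMeasure

/-! ### Riesz representation and the variation of open sets. -/

section Riesz

variable {K : Type*} [TopologicalSpace K] [CompactSpace K]

/-- A bounded functional on `C(K)` is a difference of positive functionals. -/
theorem exists_positive_sub_positive (φ : StrongDual ℝ C(K, ℝ)) :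
    ∃ ψ₁ ψ₂ : C(K, ℝ) →ₗ[ℝ] ℝ, (∀ f, 0 ≤ f → 0 ≤ ψ₁ f) ∧ (∀ f, 0 ≤ f → 0 ≤ ψ₂ f) ∧
      ∀ f, φ f = ψ₁ f - ψ₂ f := by
  -- Hahn–Banach on the square of `C(K)`: extend `(f, -f) ↦ φ f` below a sublinear functional
  -- depending only on positive parts. It vanishes at `(-f, 0)` and `(0, -f)` for `f ≥ 0`, so the
  -- extension is positive in each coordinate.
  let D : Submodule ℝ (C(K, ℝ) × C(K, ℝ)) :=
    LinearMap.ker (LinearMap.fst ℝ C(K, ℝ) C(K, ℝ) + LinearMap.snd ℝ C(K, ℝ) C(K, ℝ))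
  let F : (C(K, ℝ) × C(K, ℝ)) →ₗ.[ℝ] ℝ :=
    ⟨D, (φ.toLinearMap ∘ₗ LinearMap.fst ℝ C(K, ℝ) C(K, ℝ)) ∘ₗ D.subtype⟩
  have norm_sup_add (f g : C(K, ℝ)) : ‖(f + g) ⊔ 0‖ ≤ ‖f ⊔ 0‖ + ‖g ⊔ 0‖ := by
    rw [ContinuousMap.norm_le _ (by positivity)]
    intro x
    have h1 := (f ⊔ 0).norm_coe_le_norm x
    have h2 := (g ⊔ 0).norm_coe_le_norm x
    simp only [ContinuousMap.sup_apply, ContinuousMap.zero_apply, ContinuousMap.add_apply,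
      Real.norm_eq_abs] at *
    grind
  have norm_sup_smul (c : ℝ) (hc : 0 < c) (f : C(K, ℝ)) : ‖(c • f) ⊔ 0‖ = c * ‖f ⊔ 0‖ := by
    rw [← Real.norm_of_nonneg hc.le, ← norm_smul, Real.norm_of_nonneg hc.le]
    congr 1
    ext x
    simp [mul_max_of_nonneg, hc.le]
  obtain ⟨g, hg, hle⟩ := exists_extension_of_le_sublinear F
    (fun f => ‖φ‖ * max ‖f.1 ⊔ 0‖ ‖f.2 ⊔ 0‖)
    (fun c hc f => by
      simp only [Prod.smul_fst, Prod.smul_snd, norm_sup_smul c hc, ← mul_max_of_nonneg _ _ hc.le]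
      ring)
    (fun f g => by
      rw [← mul_add]
      refine mul_le_mul_of_nonneg_left (max_le ?_ ?_) (norm_nonneg φ)
      · exact (norm_sup_add _ _).trans (add_le_add (le_max_left _ _) (le_max_left _ _))
      · exact (norm_sup_add _ _).trans (add_le_add (le_max_right _ _) (le_max_right _ _)))
    (by
      rintro ⟨⟨f, f'⟩, hf⟩
      obtain rfl : f' = -f := by
        have : f + f' = 0 := hf
        exact (neg_eq_of_add_eq_zero_right this).symm
      change φ f ≤ _
      refine (le_abs_self _).trans ((φ.le_opNorm f).trans ?_)
      refine mul_le_mul_of_nonneg_left ?_ (norm_nonneg _)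
      rw [ContinuousMap.norm_le _ (by positivity)]
      intro x
      have h1 := (f ⊔ 0).norm_coe_le_norm x
      have h2 := (-f ⊔ 0).norm_coe_le_norm x
      simp only [ContinuousMap.sup_apply, ContinuousMap.zero_apply, ContinuousMap.neg_apply,
        Real.norm_eq_abs] at *
      grind)
  refine ⟨g ∘ₗ LinearMap.inl ℝ _ _, g ∘ₗ LinearMap.inr ℝ _ _, fun f hf => ?_, fun f hf => ?_,
    fun f => ?_⟩
  · have := hle (-f, 0)
    have h0 : -f ⊔ 0 = 0 := sup_eq_right.2 (neg_nonpos.2 hf)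
    have h1 : ((-f, 0) : C(K, ℝ) × C(K, ℝ)) = -(f, 0) := by simp
    simp only [h0, h1, map_neg] at this
    simpa using this
  · have := hle (0, -f)
    have h0 : -f ⊔ 0 = 0 := sup_eq_right.2 (neg_nonpos.2 hf)
    have h1 : ((0, -f) : C(K, ℝ) × C(K, ℝ)) = -(0, f) := by simp
    simp only [h0, h1, map_neg] at this
    simpa using this
  · have h1 : φ f = g (f, -f) := (hg ⟨(f, -f), by simp [F, D]⟩).symm
    have h2 : ((f, -f) : C(K, ℝ) × C(K, ℝ)) = (f, 0) - (0, f) := by simp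
    rw [h1, h2, map_sub]
    rfl

variable [T2Space K] [MeasurableSpace K] [BorelSpace K]

theorem exists_regular_of_positive (ψ : C(K, ℝ) →ₗ[ℝ] ℝ) (hψ : ∀ f, 0 ≤ f → 0 ≤ ψ f) :
    ∃ μ : Measure K, IsFiniteMeasure μ ∧ μ.Regular ∧ ∀ f : C(K, ℝ), ψ f = ∫ x, f x ∂μ := by
  let Λ : CompactlySupportedContinuousMap K ℝ →ₚ[ℝ] ℝ := PositiveLinearMap.mk₀
    { toFun := fun f => ψ f.toContinuousMap
      map_add' := fun f g => map_add ψ _ _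
      map_smul' := fun c f => map_smul ψ _ _ } fun f hf => hψ _ hf
  refine ⟨RealRMK.rieszMeasure Λ, inferInstance, inferInstance, fun f => ?_⟩
  exact (RealRMK.integral_rieszMeasure Λ
    (CompactlySupportedContinuousMap.continuousMapEquiv f)).symm

omit [T2Space K] in
theorem integrable_continuousMap (f : C(K, ℝ)) (μ : Measure K) [IsFiniteMeasure μ] :
    Integrable (fun x => f x) μ :=
  f.continuous.integrable_of_hasCompactSupport (HasCompactSupport.of_compactSpace _)

theorem representedBy_toSignedMeasure_sub {φ : StrongDual ℝ C(K, ℝ)} {p q : Measure K}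
    [IsFiniteMeasure p] [IsFiniteMeasure q] (hp : p.Regular) (hq : q.Regular)
    (h : ∀ f : C(K, ℝ), φ f = ∫ x, f x ∂p - ∫ x, f x ∂q) :
    RepresentedBy φ (p.toSignedMeasure - q.toSignedMeasure) := by
  have : (p + q).Regular := regular_add
  refine ⟨regular_of_le (totalVariation_toSignedMeasure_sub_le p q), fun f => ?_⟩
  have key := congrArg (fun μ : Measure K => ∫ x, f x ∂μ)
    (posPart_add_eq_add_negPart (rfl : p.toSignedMeasure - q.toSignedMeasure = _))
  simp only [integral_add_measure (integrable_continuousMap f _) (integrable_continuousMap f _)]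
    at key
  rw [h]
  linarith

theorem exists_representedBy (φ : StrongDual ℝ C(K, ℝ)) : ∃ μ, RepresentedBy φ μ := by
  obtain ⟨ψ₁, ψ₂, h₁, h₂, h⟩ := exists_positive_sub_positive φ
  obtain ⟨p, _, hp, hψp⟩ := exists_regular_of_positive ψ₁ h₁
  obtain ⟨q, _, hq, hψq⟩ := exists_regular_of_positive ψ₂ h₂
  exact ⟨_, representedBy_toSignedMeasure_sub hp hq fun f => by rw [h, hψp, hψq]⟩

namespace RepresentedBy

variable {φ ψ : StrongDual ℝ C(K, ℝ)} {μ ν : SignedMeasure K}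

theorem add (hφ : RepresentedBy φ μ) (hψ : RepresentedBy ψ ν) :
    RepresentedBy (φ + ψ) (μ + ν) := by
  have := hφ.1
  have := hψ.1
  have hp : (μ.toJordanDecomposition.posPart + ν.toJordanDecomposition.posPart).Regular :=
    have := regular_of_le (posPart_le_totalVariation μ)
    have := regular_of_le (posPart_le_totalVariation ν)
    regular_add
  have hq : (μ.toJordanDecomposition.negPart + ν.toJordanDecomposition.negPart).Regular :=
    have := regular_of_le (negPart_le_totalVariation μ)
    have := regular_of_le (negPart_le_totalVariation ν)
    regular_add
  have key : μ + ν = (μ.toJordanDecomposition.posPart +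
      ν.toJordanDecomposition.posPart).toSignedMeasure - (μ.toJordanDecomposition.negPart +
      ν.toJordanDecomposition.negPart).toSignedMeasure := by
    rw [Measure.toSignedMeasure_add, Measure.toSignedMeasure_add, add_sub_add_comm,
      toSignedMeasure_posPart_sub_negPart, toSignedMeasure_posPart_sub_negPart]
  rw [key]
  refine representedBy_toSignedMeasure_sub hp hq fun f => ?_
  rw [integral_add_measure (integrable_continuousMap f _) (integrable_continuousMap f _),
    integral_add_measure (integrable_continuousMap f _) (integrable_continuousMap f _),
    add_apply, hφ.2, hψ.2]
  ring

omit [CompactSpace K] [T2Space K] [BorelSpace K] in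
theorem unique (hφ : RepresentedBy φ μ) (hψ : RepresentedBy ψ μ) : φ = ψ := by
  ext f
  rw [hφ.2, hψ.2]

end RepresentedBy

/-- Pointwise, `f` dominates the indicator of `O` minus twice that of `O \ C`. -/
theorem measureReal_sub_le_integral {μ : Measure K} [IsFiniteMeasure μ] {O C : Set K}
    (hO : IsOpen O) (hC : IsCompact C) {f : C(K, ℝ)} (h1 : ∀ x ∈ C, 1 ≤ f x) (hf : ∀ x, -1 ≤ f x)
    (h0 : ∀ x ∉ O, f x = 0) : μ.real O - 2 * μ.real (O \ C) ≤ ∫ x, f x ∂μ := by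
  have hOC : MeasurableSet (O \ C) := hO.measurableSet.diff hC.measurableSet
  have hi : Integrable (fun x => O.indicator (1 : K → ℝ) x) μ :=
    (integrable_const 1).indicator hO.measurableSet
  have hi' : Integrable (fun x => 2 * (O \ C).indicator (1 : K → ℝ) x) μ :=
    ((integrable_const 1).indicator hOC).const_mul 2
  rw [← integral_indicator_one hO.measurableSet, ← integral_indicator_one hOC,
    ← integral_const_mul, ← integral_sub hi hi']
  refine integral_mono (hi.sub hi') (integrable_continuousMap f μ) fun x => ?_
  have := h1 x
  have := hf x
  have := h0 x
  simp only [Set.indicator, Set.mem_sdiff, Pi.one_apply]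
  split_ifs <;> grind

/-- The variation of an open set is the supremum over the functions supported on it. -/
theorem RepresentedBy.isLUB_isOpen {φ : StrongDual ℝ C(K, ℝ)} {μ : SignedMeasure K}
    (hφ : RepresentedBy φ μ) {O : Set K} (hO : IsOpen O) :
    IsLUB (φ '' {f | ‖f‖ ≤ 1 ∧ ∀ x ∉ O, f x = 0}) (μ.totalVariation.real O) := by
  have := hφ.1
  set p := μ.toJordanDecomposition.posPart with hp
  set q := μ.toJordanDecomposition.negPart with hq
  have : p.Regular := regular_of_le (posPart_le_totalVariation μ)
  have : q.Regular := regular_of_le (negPart_le_totalVariation μ)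
  have hμ (A : Set K) : μ.totalVariation.real A = p.real A + q.real A := measureReal_add_apply
  constructor
  · rintro _ ⟨f, ⟨hf, hf0⟩, rfl⟩
    have bound (x : K) : |f x| ≤ O.indicator (1 : K → ℝ) x := by
      by_cases hx : x ∈ O
      · simpa [hx] using (f.norm_coe_le_norm x).trans hf
      · simp [hx, hf0 x hx]
    have int (m : Measure K) [IsFiniteMeasure m] : |∫ x, f x ∂m| ≤ m.real O := by
      refine (abs_integral_le_integral_abs).trans ?_
      rw [← integral_indicator_one hO.measurableSet]
      exact integral_mono (integrable_continuousMap f m).abs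
        ((integrable_const 1).indicator hO.measurableSet) bound
    rw [hφ.2, hμ]
    have h1 := abs_le.1 (int p)
    have h2 := abs_le.1 (int q)
    linarith
  · intro b hb
    refine le_of_forall_pos_le_add fun ε hε => ?_
    obtain ⟨P, hP, hpP, hqP⟩ := μ.toJordanDecomposition.mutuallySingular
    -- Each of `p`, `q` loses twice the mass missed by its compact set, so a quarter of `ε` each
    -- suffices.
    have hε4 : ENNReal.ofReal (ε / 4) ≠ 0 := by simpa using hε
    obtain ⟨C, hCO, hC, hpC⟩ := (hO.measurableSet.diff hP).exists_isCompact_sdiff_lt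
      (measure_ne_top p _) hε4
    obtain ⟨D, hDO, hD, hqD⟩ := (hO.measurableSet.inter hP).exists_isCompact_sdiff_lt
      (measure_ne_top q _) hε4
    have hpC' : p.real (O \ C) ≤ ε / 4 := by
      refine ENNReal.toReal_le_of_le_ofReal (by positivity) (le_trans ?_ hpC.le)
      calc p (O \ C) ≤ p (((O \ P) \ C) ∪ P) := measure_mono (by grind)
        _ ≤ p ((O \ P) \ C) + p P := measure_union_le _ _
        _ = _ := by rw [hp, hpP, add_zero]
    have hqD' : q.real (O \ D) ≤ ε / 4 := by
      refine ENNReal.toReal_le_of_le_ofReal (by positivity) (le_trans ?_ hqD.le)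
      calc q (O \ D) ≤ q (((O ∩ P) \ D) ∪ Pᶜ) := measure_mono (by grind)
        _ ≤ q ((O ∩ P) \ D) + q Pᶜ := measure_union_le _ _
        _ = _ := by rw [hq, hqP, add_zero]
    -- The function `f - g` approximates the sign of `μ` on `O`: it is `1` on `C`, `-1` on `D` and
    -- `0` off `O`.
    obtain ⟨f, hf0, hf1, hf⟩ := exists_continuous_zero_one_of_isClosed
      (s := Oᶜ ∪ D) (t := C) (hO.isClosed_compl.union hD.isClosed) hC.isClosed
      (Set.disjoint_left.2 (by grind))
    obtain ⟨g, hg0, hg1, hg⟩ := exists_continuous_zero_one_of_isClosed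
      (s := Oᶜ ∪ C) (t := D) (hO.isClosed_compl.union hC.isClosed) hD.isClosed
      (Set.disjoint_left.2 (by grind))
    have hf0' (x : K) (hx : x ∈ Oᶜ ∪ D) : f x = 0 := hf0 hx
    have hf1' (x : K) (hx : x ∈ C) : f x = 1 := hf1 hx
    have hg0' (x : K) (hx : x ∈ Oᶜ ∪ C) : g x = 0 := hg0 hx
    have hg1' (x : K) (hx : x ∈ D) : g x = 1 := hg1 hx
    have hfx (x : K) : 0 ≤ f x ∧ f x ≤ 1 := hf x
    have hgx (x : K) : 0 ≤ g x ∧ g x ≤ 1 := hg x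
    have hle : φ (f - g) ≤ b := by
      refine hb ⟨f - g, ⟨?_, fun x hx => ?_⟩, rfl⟩
      · rw [ContinuousMap.norm_le _ zero_le_one]
        intro x
        rw [Real.norm_eq_abs, ContinuousMap.sub_apply, abs_le]
        constructor <;> linarith [hfx x, hgx x, (hfx x).1, (hfx x).2, (hgx x).1, (hgx x).2]
      · rw [ContinuousMap.sub_apply, hf0' x (Or.inl hx), hg0' x (Or.inl hx), sub_self]
    have h1 : p.real O - 2 * p.real (O \ C) ≤ ∫ x, (f - g) x ∂p := by
      refine measureReal_sub_le_integral hO hC (fun x hx => ?_) (fun x => ?_) (fun x hx => ?_)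
      · rw [ContinuousMap.sub_apply, hf1' x hx, hg0' x (Or.inr hx), sub_zero]
      · rw [ContinuousMap.sub_apply]; linarith [(hfx x).1, (hgx x).2]
      · rw [ContinuousMap.sub_apply, hf0' x (Or.inl hx), hg0' x (Or.inl hx), sub_self]
    have h2 : q.real O - 2 * q.real (O \ D) ≤ ∫ x, (g - f) x ∂q := by
      refine measureReal_sub_le_integral hO hD (fun x hx => ?_) (fun x => ?_) (fun x hx => ?_)
      · rw [ContinuousMap.sub_apply, hg1' x hx, hf0' x (Or.inr hx), sub_zero]
      · rw [ContinuousMap.sub_apply]; linarith [(hgx x).1, (hfx x).2]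
      · rw [ContinuousMap.sub_apply, hf0' x (Or.inl hx), hg0' x (Or.inl hx), sub_self]
    have h3 : ∫ x, (g - f) x ∂q = - ∫ x, (f - g) x ∂q := by
      rw [← integral_neg]
      simp
    rw [hφ.2] at hle
    rw [hμ]
    linarith

theorem RepresentedBy.norm_eq {φ : StrongDual ℝ C(K, ℝ)} {μ : SignedMeasure K}
    (hφ : RepresentedBy φ μ) : ‖φ‖ = μ.totalVariation.real Set.univ := by
  refine IsLUB.unique ?_ (hφ.isLUB_isOpen isOpen_univ)
  rw [← supSeminorm_closedBall φ]
  convert isLUB_supSeminorm (subset_refl (Metric.closedBall (0 : C(K, ℝ)) 1))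
    (by simp) (by simp) φ using 2
  congr 1
  ext f
  simp

end Riesz

/-! ### Families with cores built from a Gruenhage family. -/

section CoreFamily

variable {X : Type*}

/-- A family of open sets containing the open core `R`, any two distinct members of which meet
exactly in `R`. -/
structure IsCoreFamily [TopologicalSpace X] (R : Set X) (U : Set (Set X)) : Prop where
  isOpen_core : IsOpen R
  isOpen_mem : ∀ u ∈ U, IsOpen u
  core_subset : ∀ u ∈ U, R ⊆ u
  inter_eq : ∀ u ∈ U, ∀ v ∈ U, u ≠ v → u ∩ v = R

/-- The points lying in more than `k` members of `U`. -/
def multiplicityCore (U : Set (Set X)) (k : ℕ) : Set X :=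
  {x | ∃ F : Finset (Set X), (F : Set (Set X)) ⊆ U ∧ F.card = k + 1 ∧ x ∈ ⋂₀ (F : Set (Set X))}

/-- The intersections of `k` members of `U`, enlarged by the points lying in more than `k`
members. -/
def multiplicityFamily (U : Set (Set X)) (k : ℕ) : Set (Set X) :=
  {V | ∃ F : Finset (Set X), (F : Set (Set X)) ⊆ U ∧ F.card = k ∧
    V = ⋂₀ (F : Set (Set X)) ∪ multiplicityCore U k}

theorem mem_multiplicityCore_of_lt {U : Set (Set X)} {k : ℕ} {F : Finset (Set X)}
    (hF : (F : Set (Set X)) ⊆ U) (hk : k < F.card) {x : X} (hx : x ∈ ⋂₀ (F : Set (Set X))) :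
    x ∈ multiplicityCore U k := by
  obtain ⟨G, hGF, hG⟩ := Finset.exists_subset_card_eq (Nat.succ_le_of_lt hk)
  exact ⟨G, (Finset.coe_subset.2 hGF).trans hF, hG,
    Set.sInter_subset_sInter (Finset.coe_subset.2 hGF) hx⟩

/-- The union of two distinct `k`-element subfamilies has more than `k` members, so a point of both
intersections lies in the core. -/
theorem isCoreFamily_multiplicity [TopologicalSpace X] {U : Set (Set X)}
    (hU : ∀ u ∈ U, IsOpen u) (k : ℕ) :
    IsCoreFamily (multiplicityCore U k) (multiplicityFamily U k) := by
  classical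
  have inter_open (F : Finset (Set X)) (hF : (F : Set (Set X)) ⊆ U) :
      IsOpen (⋂₀ (F : Set (Set X))) := F.finite_toSet.isOpen_sInter fun u hu => hU u (hF hu)
  have core_open : IsOpen (multiplicityCore U k) := by
    have : multiplicityCore U k = ⋃ F ∈ {F : Finset (Set X) | (F : Set (Set X)) ⊆ U ∧
        F.card = k + 1}, ⋂₀ (F : Set (Set X)) := by
      ext x
      simp [multiplicityCore, and_assoc]
    rw [this]
    exact isOpen_biUnion fun F hF => inter_open F hF.1
  refine ⟨core_open, ?_, ?_, ?_⟩
  · rintro _ ⟨F, hF, -, rfl⟩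
    exact (inter_open F hF).union core_open
  · rintro _ ⟨F, -, -, rfl⟩
    exact Set.subset_union_right
  · rintro _ ⟨F, hF, hFk, rfl⟩ _ ⟨G, hG, hGk, rfl⟩ hne
    rw [← Set.inter_union_distrib_right]
    refine Set.union_eq_right.2 fun x hx => ?_
    refine mem_multiplicityCore_of_lt (F := F ∪ G) ?_ ?_ ?_
    · rw [Finset.coe_union]
      exact Set.union_subset hF hG
    · by_contra! hle
      have h1 := Finset.eq_of_subset_of_card_le (Finset.subset_union_left (s₁ := F) (s₂ := G))
        (hle.trans hFk.ge)
      have h2 := Finset.eq_of_subset_of_card_le (Finset.subset_union_right (s₁ := F) (s₂ := G))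
        (hle.trans hGk.ge)
      exact hne (by rw [h1, ← h2])
    · rw [Finset.coe_union, Set.sInter_union]
      exact hx

/-- Let `x` lie in exactly `k` members. If `y` lies in more, then `k + 1` members through `y` give a
set missing `x`. Otherwise the intersection of the members through `x` works: were `y` in it, no
member could contain exactly one of the points. -/
theorem exists_multiplicityFamily_separating {U : Set (Set X)} {x y : X}
    (hne : ∃ u ∈ U, (x ∈ u ∧ y ∉ u) ∨ (x ∉ u ∧ y ∈ u)) (hfin : {u | u ∈ U ∧ x ∈ u}.Finite) :
    ∃ k, ∃ V ∈ multiplicityFamily U k, (x ∈ V ∧ y ∉ V) ∨ (x ∉ V ∧ y ∈ V) := by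
  classical
  set F := hfin.toFinset with hF
  have hFU : (F : Set (Set X)) ⊆ U := fun u hu => by
    simp only [hF, Set.Finite.coe_toFinset] at hu
    exact hu.1
  have hxF : x ∈ ⋂₀ (F : Set (Set X)) := fun u hu => by
    simp only [hF, Set.Finite.coe_toFinset] at hu
    exact hu.2
  have card_le (G : Finset (Set X)) (hG : (G : Set (Set X)) ⊆ U)
      (hx : x ∈ ⋂₀ (G : Set (Set X))) : G.card ≤ F.card :=
    Finset.card_le_card fun u hu => by simpa [hF] using ⟨hG hu, hx u hu⟩
  by_cases hy : y ∈ multiplicityCore U F.card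
  · obtain ⟨G, hG, hGk, hyG⟩ := hy
    refine ⟨F.card + 1, _, ⟨G, hG, hGk, rfl⟩, Or.inr ⟨?_, Or.inl hyG⟩⟩
    rintro (h | ⟨H, hH, hHk, hxH⟩)
    · have := card_le G hG h
      omega
    · have := card_le H hH hxH
      omega
  · refine ⟨F.card, _, ⟨F, hFU, rfl, rfl⟩, Or.inl ⟨Or.inl hxF, ?_⟩⟩
    rintro (h | h)
    · obtain ⟨u, hu, ⟨hxu, hyu⟩ | ⟨hxu, hyu⟩⟩ := hne
      · exact hyu (h u (by simpa [hF] using ⟨hu, hxu⟩))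
      · have huF : u ∉ F := by simp [hF, hxu]
        refine hy ⟨insert u F, ?_, Finset.card_insert_of_notMem huF, ?_⟩
        · rw [Finset.coe_insert]
          exact Set.insert_subset hu hFU
        · rw [Finset.coe_insert, Set.sInter_insert]
          exact ⟨hyu, h⟩
    · exact hy h

/-- The common refinement of two families with cores. -/
def meetFamily (p q : Set X × Set (Set X)) : Set X × Set (Set X) :=
  let R := (p.1 ∩ ⋃₀ q.2) ∪ (⋃₀ p.2 ∩ q.1)
  (R, Set.image2 (fun V W => (V ∩ W) ∪ R) p.2 q.2)

/-- The traces of the members of a family off its core. -/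
def offCore (p : Set X × Set (Set X)) : Set (Set X) := (fun V => V \ p.1) '' p.2

/-- A point common to two distinct refined sets lies in two distinct members of `p.2` or of `q.2`,
hence in one of the old cores. -/
theorem isCoreFamily_meetFamily [TopologicalSpace X] {p q : Set X × Set (Set X)}
    (hp : IsCoreFamily p.1 p.2) (hq : IsCoreFamily q.1 q.2) :
    IsCoreFamily (meetFamily p q).1 (meetFamily p q).2 := by
  have hR : IsOpen (meetFamily p q).1 :=
    (hp.isOpen_core.inter (isOpen_sUnion hq.isOpen_mem)).union
      ((isOpen_sUnion hp.isOpen_mem).inter hq.isOpen_core)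
  refine ⟨hR, ?_, ?_, ?_⟩
  · rintro _ ⟨V, hV, W, hW, rfl⟩
    exact ((hp.isOpen_mem V hV).inter (hq.isOpen_mem W hW)).union hR
  · rintro _ ⟨V, hV, W, hW, rfl⟩
    exact Set.subset_union_right
  · rintro _ ⟨V, hV, W, hW, rfl⟩ _ ⟨V', hV', W', hW', rfl⟩ hne
    change (V ∩ W ∪ (meetFamily p q).1) ∩ (V' ∩ W' ∪ (meetFamily p q).1) = _
    rw [← Set.inter_union_distrib_right]
    refine Set.union_eq_right.2 fun x hx => ?_
    obtain ⟨⟨hxV, hxW⟩, hxV', hxW'⟩ := hx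
    by_cases hVV : V = V'
    · by_cases hWW : W = W'
      · subst hVV hWW
        exact absurd rfl hne
      · exact Or.inr ⟨⟨V, hV, hxV⟩, hq.inter_eq W hW W' hW' hWW ▸ ⟨hxW, hxW'⟩⟩
    · exact Or.inl ⟨hp.inter_eq V hV V' hV' hVV ▸ ⟨hxV, hxV'⟩, ⟨W, hW, hxW⟩⟩

/-- Within `V ∩ W` the new core is exactly the part lying in `p.1` or `q.1`. Thus refinement
intersects traces, and concatenating lists yields a π-system. -/
theorem offCore_meetFamily (p q : Set X × Set (Set X)) :
    offCore (meetFamily p q) = Set.image2 (· ∩ ·) (offCore p) (offCore q) := by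
  rw [offCore, offCore, offCore, Set.image2_image_left, Set.image2_image_right]
  change (fun V => V \ (meetFamily p q).1) '' Set.image2 _ _ _ = _
  rw [Set.image_image2]
  refine Set.image2_congr fun V hV W hW => ?_
  ext x
  simp only [meetFamily, Set.mem_sdiff, Set.mem_union, Set.mem_inter_iff, Set.mem_sUnion]
  grind

/-- The common refinement of a finite list of families with cores. -/
def listMeetFamily {β : Type*} (B : β → Set X × Set (Set X)) : List β → Set X × Set (Set X)
  | [] => (∅, {Set.univ})
  | b :: l => meetFamily (B b) (listMeetFamily B l)

variable {β : Type*} {B : β → Set X × Set (Set X)}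

theorem isCoreFamily_listMeetFamily [TopologicalSpace X]
    (hB : ∀ b, IsCoreFamily (B b).1 (B b).2) (l : List β) :
    IsCoreFamily (listMeetFamily B l).1 (listMeetFamily B l).2 := by
  induction l with
  | nil =>
    refine ⟨isOpen_empty, ?_, fun _ _ => Set.empty_subset _, ?_⟩
    · rintro _ rfl
      exact isOpen_univ
    · rintro _ rfl _ rfl h
      exact absurd rfl h
  | cons b l ih => exact isCoreFamily_meetFamily (hB b) ih

theorem inter_mem_offCore_listMeetFamily {l l' : List β} {A A' : Set X}
    (hA : A ∈ offCore (listMeetFamily B l)) (hA' : A' ∈ offCore (listMeetFamily B l')) :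
    A ∩ A' ∈ offCore (listMeetFamily B (l ++ l')) := by
  induction l generalizing A with
  | nil =>
    obtain ⟨_, rfl, rfl⟩ := hA
    simpa [listMeetFamily] using hA'
  | cons b l ih =>
    rw [listMeetFamily, offCore_meetFamily] at hA
    obtain ⟨C, hC, D, hD, rfl⟩ := hA
    rw [List.cons_append, listMeetFamily, offCore_meetFamily]
    exact ⟨C, hC, D ∩ A', ih hD, (Set.inter_assoc _ _ _).symm⟩

theorem listMeetFamily_singleton_fst (b : β) : (listMeetFamily B [b]).1 = (B b).1 := by
  simp [listMeetFamily, meetFamily]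

theorem mem_listMeetFamily_singleton {b : β} {V : Set X} (h : (B b).1 ⊆ V) (hV : V ∈ (B b).2) :
    V ∈ (listMeetFamily B [b]).2 :=
  ⟨V, hV, Set.univ, rfl, by simpa [listMeetFamily] using h⟩

/-- A Gruenhage space has a system of open families with cores whose traces off the cores form a
π-system, separating points by families whose cores belong to that π-system. -/
theorem IsGruenhage.exists_system [TopologicalSpace X] (hX : IsGruenhage X) :
    ∃ (R : ℕ → Set X) (U : ℕ → Set (Set X)), (∀ n, IsCoreFamily (R n) (U n)) ∧
      IsPiSystem (⋃ n, offCore (R n, U n)) ∧ Set.univ ∈ ⋃ n, offCore (R n, U n) ∧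
      ∀ x y : X, x ≠ y → ∃ n, R n ∈ ⋃ n, offCore (R n, U n) ∧
        ∃ u ∈ U n, (x ∈ u ∧ y ∉ u) ∨ (x ∉ u ∧ y ∈ u) := by
  obtain ⟨𝒰, h𝒰, hsep⟩ := hX
  -- The left families separate points. Each right family has empty core and a left core as its only
  -- member, which puts the left cores into the π-system.
  let B : (ℕ × ℕ) ⊕ (ℕ × ℕ) → Set X × Set (Set X) := Sum.elim
    (fun i => (multiplicityCore (𝒰 i.1) i.2, multiplicityFamily (𝒰 i.1) i.2))
    (fun i => (∅, {multiplicityCore (𝒰 i.1) i.2}))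
  have hmult (i : ℕ × ℕ) := isCoreFamily_multiplicity (h𝒰 i.1) i.2
  have hB (b) : IsCoreFamily (B b).1 (B b).2 := by
    rcases b with i | i
    · exact hmult i
    · refine ⟨isOpen_empty, ?_, fun _ _ => Set.empty_subset _, ?_⟩
      · rintro _ rfl
        exact (hmult i).isOpen_core
      · rintro _ rfl _ rfl h
        exact absurd rfl h
  let e : ℕ ≃ List ((ℕ × ℕ) ⊕ (ℕ × ℕ)) := (Denumerable.eqv _).symm
  have hmem (l : List ((ℕ × ℕ) ⊕ (ℕ × ℕ))) (A : Set X) (hA : A ∈ offCore (listMeetFamily B l)) :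
      A ∈ ⋃ n, offCore ((listMeetFamily B (e n)).1, (listMeetFamily B (e n)).2) := by
    rw [Set.mem_iUnion]
    exact ⟨e.symm l, by simpa using hA⟩
  refine ⟨fun n => (listMeetFamily B (e n)).1, fun n => (listMeetFamily B (e n)).2,
    fun n => isCoreFamily_listMeetFamily hB _, ?_, ?_, fun x y hxy => ?_⟩
  · intro A hA A' hA' _
    obtain ⟨n, hn⟩ := Set.mem_iUnion.1 hA
    obtain ⟨n', hn'⟩ := Set.mem_iUnion.1 hA'
    exact hmem _ _ (inter_mem_offCore_listMeetFamily hn hn')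
  · exact hmem [] _ ⟨_, rfl, by simp [listMeetFamily]⟩
  · obtain ⟨n, k, V, hV, h⟩ : ∃ n k, ∃ V ∈ multiplicityFamily (𝒰 n) k,
        (x ∈ V ∧ y ∉ V) ∨ (x ∉ V ∧ y ∈ V) := by
      obtain ⟨n, hn, hx | hy⟩ := hsep x y hxy
      · exact ⟨n, exists_multiplicityFamily_separating hn hx⟩
      · obtain ⟨k, V, hV, h⟩ := exists_multiplicityFamily_separating (x := y) (y := x)
          (by simpa only [or_comm, and_comm] using hn) hy
        exact ⟨n, k, V, hV, by simpa only [or_comm, and_comm] using h⟩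
    refine ⟨e.symm [.inl (n, k)], ?_, V, ?_, h⟩
    · simp only [Equiv.apply_symm_apply, listMeetFamily_singleton_fst]
      refine hmem [.inr (n, k)] _ ⟨_, mem_listMeetFamily_singleton (Set.empty_subset _) rfl, ?_⟩
      simp [listMeetFamily_singleton_fst, B]
    · simp only [Equiv.apply_symm_apply]
      exact mem_listMeetFamily_singleton ((hmult (n, k)).core_subset V hV) hV

end CoreFamily

/-! ### Largest values of a measure on a family with core. -/

section TopSums

variable {ι : Type*}

/-- The sum over a set of largest values dominates the sums over sets that are not larger. -/
theorem sum_le_sum_of_threshold [DecidableEq ι] {c : ι → ℝ} {δ : ℝ} (hδ : 0 ≤ δ) {G H : Finset ι}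
    (hG : ∀ i ∈ G, δ ≤ c i) (hH : ∀ i ∈ H, i ∉ G → c i ≤ δ) (hcard : H.card ≤ G.card) :
    ∑ i ∈ H, c i ≤ ∑ i ∈ G, c i := by
  -- After subtracting `δ`, terms in `G` are nonnegative and those of `H` outside `G` nonpositive;
  -- adding `δ` back favours the larger set.
  have h : ∑ i ∈ H, (c i - δ) ≤ ∑ i ∈ G, (c i - δ) :=
    calc ∑ i ∈ H, (c i - δ) ≤ ∑ i ∈ H ∩ G, (c i - δ) := by
          rw [← Finset.sum_inter_add_sum_sdiff H G]
          refine add_le_of_nonpos_right (Finset.sum_nonpos fun i hi => ?_)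
          rw [Finset.mem_sdiff] at hi
          exact sub_nonpos.2 (hH i hi.1 hi.2)
      _ ≤ ∑ i ∈ G, (c i - δ) :=
          Finset.sum_le_sum_of_subset_of_nonneg Finset.inter_subset_right
            fun i hi _ => sub_nonneg.2 (hG i hi)
  rw [Finset.sum_sub_distrib, Finset.sum_sub_distrib, Finset.sum_const, Finset.sum_const,
    nsmul_eq_mul, nsmul_eq_mul] at h
  have : (H.card : ℝ) ≤ G.card := by exact_mod_cast hcard
  nlinarith

end TopSums

section CoreFamilyMeasure

variable {X : Type*} [TopologicalSpace X] [MeasurableSpace X] [BorelSpace X]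
  {R : Set X} {U : Set (Set X)}

theorem IsCoreFamily.measureReal_core_union (hU : IsCoreFamily R U) (α : Measure X) [IsFiniteMeasure α]
    {F : Finset (Set X)} (hF : (F : Set (Set X)) ⊆ U) :
    α.real (R ∪ ⋃₀ (F : Set (Set X))) = α.real R + ∑ V ∈ F, α.real (V \ R) := by
  have hR := hU.isOpen_core.measurableSet
  have hV (V) (hV : V ∈ F) : MeasurableSet (V \ R) :=
    (hU.isOpen_mem V (hF hV)).measurableSet.diff hR
  have h : R ∪ ⋃₀ (F : Set (Set X)) = R ∪ ⋃ V ∈ F, V \ R := by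
    ext x
    simp only [Set.mem_union, Set.mem_sUnion, Set.mem_iUnion, Finset.mem_coe, Set.mem_sdiff]
    grind
  rw [h, measureReal_union ?_ (F.measurableSet_biUnion hV) (measure_ne_top _ _)
    (measure_ne_top _ _), measureReal_biUnion_finset ?_ hV]
  · intro V hV W hW hne
    have := hU.inter_eq V (hF hV) W (hF hW) hne
    exact Set.disjoint_left.2 fun x hx hx' => hx.2 (this ▸ ⟨hx.1, hx'.1⟩)
  · exact Set.disjoint_left.2 fun x hx hx' => by
      simp only [Set.mem_iUnion, Set.mem_sdiff] at hx'
      grind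

theorem IsCoreFamily.finite_lt (hU : IsCoreFamily R U) (γ : Measure X) [IsFiniteMeasure γ]
    {δ : ℝ} (hδ : 0 < δ) : {V | V ∈ U ∧ δ < γ.real (V \ R)}.Finite := by
  have hfin := Measure.finite_const_le_meas_of_disjoint_iUnion γ (ε := ENNReal.ofReal δ)
    (by simpa using hδ) (As := fun V : U => (V : Set X) \ R)
    (fun V => (hU.isOpen_mem V V.2).measurableSet.diff hU.isOpen_core.measurableSet)
    (fun V W hne => by
      have := hU.inter_eq V V.2 W W.2 (Subtype.coe_ne_coe.2 hne)
      exact Set.disjoint_left.2 fun x hx hx' => hx.2 (this ▸ ⟨hx.1, hx'.1⟩))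
    (measure_ne_top _ _)
  refine (hfin.image Subtype.val).subset ?_
  rintro V ⟨hV, hlt⟩
  refine ⟨⟨V, hV⟩, ?_, rfl⟩
  exact (ENNReal.ofReal_le_iff_le_toReal (measure_ne_top _ _)).2 hlt.le

theorem IsCoreFamily.countable_ne_zero (hU : IsCoreFamily R U) (γ : Measure X) [IsFiniteMeasure γ] :
    {V | V ∈ U ∧ γ (V \ R) ≠ 0}.Countable := by
  have : {V | V ∈ U ∧ γ (V \ R) ≠ 0} ⊆ ⋃ n : ℕ, {V | V ∈ U ∧ 1 / (n + 1 : ℝ) < γ.real (V \ R)} := by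
    rintro V ⟨hV, hne⟩
    have hpos : 0 < γ.real (V \ R) := ENNReal.toReal_pos hne (measure_ne_top _ _)
    obtain ⟨n, hn⟩ := exists_nat_one_div_lt hpos
    exact Set.mem_iUnion.2 ⟨n, hV, hn⟩
  exact (Set.countable_iUnion fun n => (hU.finite_lt γ (by positivity)).countable).mono this

/-- Two measures which attain the suprema defining the seminorms of `IsSupSeminorm` simultaneously
agree on the members of the family off the core. -/
theorem IsCoreFamily.measureReal_sdiff_eq (hU : IsCoreFamily R U) {α β : Measure X}
    [IsFiniteMeasure α] [IsFiniteMeasure β] {t : ℕ → ℝ}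
    (hα : ∀ m, ∀ F : Finset (Set X), (F : Set (Set X)) ⊆ U → F.card ≤ m →
      α.real (R ∪ ⋃₀ (F : Set (Set X))) ≤ t m)
    (hβ : ∀ m, ∀ F : Finset (Set X), (F : Set (Set X)) ⊆ U → F.card ≤ m →
      β.real (R ∪ ⋃₀ (F : Set (Set X))) ≤ t m)
    (hαβ : ∀ m, IsLUB {r : ℝ | ∃ F : Finset (Set X), (F : Set (Set X)) ⊆ U ∧ F.card ≤ m ∧
      r = (α + β).real (R ∪ ⋃₀ (F : Set (Set X)))} (t m + t m)) {V : Set X} (hV : V ∈ U) :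
    α.real (V \ R) = β.real (V \ R) := by
  classical
  have hadd (A : Set X) : (α + β).real A = α.real A + β.real A := measureReal_add_apply
  set δ := (α + β).real (V \ R) with hδ
  -- Such a `G` carries the top sum, so `α + β` attains `t m + t m` on it. Since neither measure
  -- exceeds `t m`, both attain it.
  have key (G : Finset (Set X)) (hG : (G : Set (Set X)) ⊆ U)
      (h₁ : ∀ W ∈ G, δ ≤ (α + β).real (W \ R))
      (h₂ : ∀ W ∈ U, W ∉ G → (α + β).real (W \ R) ≤ δ) :
      α.real (R ∪ ⋃₀ (G : Set (Set X))) = β.real (R ∪ ⋃₀ (G : Set (Set X))) := by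
    have hle : t G.card + t G.card ≤ (α + β).real (R ∪ ⋃₀ (G : Set (Set X))) := by
      refine (hαβ G.card).2 ?_
      rintro _ ⟨H, hH, hcard, rfl⟩
      rw [hU.measureReal_core_union _ hH, hU.measureReal_core_union _ hG]
      gcongr 1
      exact sum_le_sum_of_threshold measureReal_nonneg h₁ (fun W hW => h₂ W (hH hW)) hcard
    rw [hadd] at hle
    have h1 := hα G.card G hG le_rfl
    have h2 := hβ G.card G hG le_rfl
    linarith
  rcases (measureReal_nonneg : 0 ≤ δ).eq_or_lt with h0 | h0
  · have := hadd (V \ R)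
    have h1 : 0 ≤ α.real (V \ R) := measureReal_nonneg
    have h2 : 0 ≤ β.real (V \ R) := measureReal_nonneg
    linarith
  -- Both `F` and `insert V F` carry top sums; subtracting the two equalities isolates `V \ R`.
  · set F := (hU.finite_lt (α + β) h0).toFinset with hF
    have hmem (W : Set X) : W ∈ F ↔ W ∈ U ∧ δ < (α + β).real (W \ R) := by
      rw [hF, Set.Finite.mem_toFinset, Set.mem_ofPred_eq]
    have hFU : (F : Set (Set X)) ⊆ U := fun W hW => ((hmem W).1 hW).1
    have hVF : V ∉ F := fun h => lt_irrefl _ ((hmem V).1 h).2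
    have hIU : ((insert V F : Finset (Set X)) : Set (Set X)) ⊆ U := by
      rw [Finset.coe_insert]
      exact Set.insert_subset hV hFU
    have h1 := key F hFU (fun W hW => ((hmem W).1 hW).2.le)
      fun W hW hWF => not_lt.1 fun h => hWF ((hmem W).2 ⟨hW, h⟩)
    have h2 := key (insert V F) hIU
      (fun W hW => by
        rcases Finset.mem_insert.1 hW with rfl | hW
        · exact le_rfl
        · exact ((hmem W).1 hW).2.le)
      fun W hW hWF => not_lt.1 fun h =>
        hWF (Finset.mem_insert_of_mem ((hmem W).2 ⟨hW, h⟩))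
    rw [hU.measureReal_core_union _ hFU, hU.measureReal_core_union _ hFU] at h1
    rw [hU.measureReal_core_union _ hIU, hU.measureReal_core_union _ hIU, Finset.sum_insert hVF,
      Finset.sum_insert hVF] at h2
    linarith

end CoreFamilyMeasure

/-! ### Regular measures determined by a separating system. -/

section Uniqueness

variable {X : Type*} [TopologicalSpace X] [MeasurableSpace X] [BorelSpace X]

/-- The family may be uncountable; inner regularity reduces to a compact set, which finitely many
members cover. -/
theorem measure_sUnion_sdiff_null {γ : Measure X} [IsFiniteMeasure γ] [γ.Regular] {R : Set X}
    (hR : MeasurableSet R) {U : Set (Set X)} (hU : ∀ V ∈ U, IsOpen V)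
    (h : ∀ V ∈ U, γ (V \ R) = 0) : γ (⋃₀ U \ R) = 0 := by
  by_contra hne
  have hm : MeasurableSet (⋃₀ U \ R) := (isOpen_sUnion hU).measurableSet.diff hR
  obtain ⟨C, hCU, hC, hpos⟩ :=
    hm.exists_lt_isCompact_of_ne_top (measure_ne_top γ _) (pos_iff_ne_zero.2 hne)
  obtain ⟨T, hTU, hT, hCT⟩ := hC.elim_finite_subcover_image (c := id) hU
    ((hCU.trans Set.sdiff_subset).trans Set.sUnion_eq_biUnion.subset)
  refine hpos.ne' (measure_mono_null (t := ⋃ V ∈ T, V \ R) (fun x hx => ?_)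
    ((measure_biUnion_null_iff hT.countable).2 fun V hV => h V (hTU hV)))
  obtain ⟨V, hV, hxV⟩ := Set.mem_iUnion₂.1 (hCT hx)
  exact Set.mem_biUnion hV ⟨hxV, (hCU hx).2⟩

variable [T2Space X]

/-- Regular measures which agree on a σ-algebra containing countably many open sets that separate
the points off a null set are equal. -/
theorem eq_of_countable_separating {α β : Measure X} [IsFiniteMeasure α] [IsFiniteMeasure β]
    [α.Regular] [β.Regular] {𝒮 : Set (Set X)}
    (h : ∀ A, MeasurableSet[MeasurableSpace.generateFrom 𝒮] A → α A = β A) {𝒲 : Set (Set X)} (hc : 𝒲.Countable)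
    (hopen : ∀ W ∈ 𝒲, IsOpen W) 
    (hm : ∀ W ∈ 𝒲, MeasurableSet[MeasurableSpace.generateFrom 𝒮] W) {Z : Set X}
    (hZ : MeasurableSet Z) (hαZ : α Z = 0) (hβZ : β Z = 0)
    (hsep : ∀ x ∉ Z, ∀ y ∉ Z, (∀ W ∈ 𝒲, x ∈ W ↔ y ∈ W) → x = y) : α = β := by
  have : Countable 𝒲 := hc
  let T : X → 𝒲 → Bool := fun x W => (W : Set X).boolIndicator x
  have hT : Measurable[MeasurableSpace.generateFrom 𝒮] T := by
    refine @measurable_pi_lambda _ _ _ (MeasurableSpace.generateFrom 𝒮) _ _ fun W => ?_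
    refine @measurable_to_bool _ (MeasurableSpace.generateFrom 𝒮) _ ?_
    rw [Set.preimage_boolIndicator_true]
    exact hm W W.2
  -- On such `L` the map `T` is continuous, so `T '' L` is compact and its preimage lies in the
  -- small σ-algebra. Separation off `Z` makes this preimage differ from `L` only inside `Z`.
  have key (L : Set X) (hL : IsCompact L) (hLZ : ∀ x ∈ L, x ∉ Z)
      (hcont : ∀ W ∈ 𝒲, ContinuousOn (Set.boolIndicator W) L) : α L = β L := by
    have hTL : ContinuousOn T L := continuousOn_pi.2 fun W => hcont W W.2
    have hA : MeasurableSet[MeasurableSpace.generateFrom 𝒮] (T ⁻¹' (T '' L)) :=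
      hT (hL.image_of_continuousOn hTL).isClosed.measurableSet
    have heq (γ : Measure X) (hγ : γ Z = 0) : γ (T ⁻¹' (T '' L)) = γ L := by
      refine le_antisymm ?_ (measure_mono (Set.subset_preimage_image T L))
      refine (measure_mono (t := L ∪ Z) ?_).trans
        ((measure_union_le _ _).trans (by rw [hγ, add_zero]))
      rintro x ⟨y, hy, hxy⟩
      by_cases hxZ : x ∈ Z
      · exact Or.inr hxZ
      · refine Or.inl ?_
        have : y = x := hsep y (hLZ y hy) x hxZ fun W hW => by
          have := congrFun hxy ⟨W, hW⟩
          simp only [T, Set.boolIndicator] at this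
          split_ifs at this <;> simp_all
        exact this ▸ hy
    rw [← heq α hαZ, ← heq β hβZ, h _ hA]
  have : (α + β).Regular := regular_add
  have approx (C : Set X) (hC : IsClosed C) (ε : ENNReal) (hε : ε ≠ 0) :
      ∃ L ⊆ C, α L = β L ∧ (α + β) (C \ L) ≤ ε := by
    have hε2 := (ENNReal.half_pos hε).ne'
    obtain ⟨ε', hε'pos, hε'sum⟩ := ENNReal.exists_pos_sum_of_countable' hε2 𝒲
    obtain ⟨L, hLC, hL, hLlt⟩ := (hC.measurableSet.diff hZ).exists_isCompact_sdiff_lt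
      (measure_ne_top (α + β) _) hε2
    have hex (W : 𝒲) := (hopen W W.2).measurableSet.exists_isCompact_sdiff_lt
      (measure_ne_top (α + β) _) (hε'pos W).ne'
    choose D hDW hD hDlt using hex
    -- Inside this set each `W` coincides with the compact `D W`, hence is relatively clopen; the
    -- discarded parts `W \ D W` have total mass at most `ε / 2`.
    have hM : IsClosed (⋂ W : 𝒲, D W ∪ (W : Set X)ᶜ) :=
      isClosed_iInter fun W => (hD W).isClosed.union (hopen W W.2).isClosed_compl
    refine ⟨L ∩ ⋂ W : 𝒲, D W ∪ (W : Set X)ᶜ,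
      Set.inter_subset_left.trans (hLC.trans Set.sdiff_subset),
      key _ (hL.inter_right hM) (fun x hx => (hLC hx.1).2) fun W hW => ?_, ?_⟩
    · rw [continuousOn_boolIndicator_iff_isClopen]
      refine ⟨?_, (hopen W hW).preimage continuous_subtype_val⟩
      convert (hD ⟨W, hW⟩).isClosed.preimage continuous_subtype_val using 1
      ext ⟨x, hx⟩
      have := Set.mem_iInter.1 hx.2 ⟨W, hW⟩
      have := @hDW ⟨W, hW⟩ x
      simp only [Set.mem_preimage, Set.mem_union, Set.mem_compl_iff] at *
      tauto
    · calc (α + β) (C \ (L ∩ ⋂ W : 𝒲, D W ∪ (W : Set X)ᶜ))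
          ≤ (α + β) ((Z ∪ ((C \ Z) \ L)) ∪ ⋃ W : 𝒲, (W : Set X) \ D W) := by
            refine measure_mono fun x hx => ?_
            simp only [Set.mem_sdiff, Set.mem_inter_iff, Set.mem_iInter, Set.mem_union,
              Set.mem_compl_iff, Set.mem_iUnion] at *
            by_contra! hcon
            exact hx.2 ⟨by tauto, fun W => by have := hcon.2 W; tauto⟩
        _ ≤ ((α + β) Z + (α + β) ((C \ Z) \ L)) + ∑' W : 𝒲, (α + β) ((W : Set X) \ D W) :=
            (measure_union_le _ _).trans
              (add_le_add (measure_union_le _ _) (measure_iUnion_le _))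
        _ ≤ (0 + ε / 2) + ε / 2 := by
            gcongr
            · simp [hαZ, hβZ]
            · exact (ENNReal.tsum_le_tsum fun W => (hDlt W).le).trans hε'sum.le
        _ = ε := by rw [zero_add, ENNReal.add_halves]
  have le_aux {μ ν γ : Measure X} (hμ : μ ≤ γ) {C L : Set X} {ε : ENNReal} (hLC : L ⊆ C)
      (hL : μ L = ν L) (hγ : γ (C \ L) ≤ ε) : μ C ≤ ν C + ε :=
    calc μ C ≤ μ (C ∩ L) + μ (C \ L) := measure_le_inter_add_sdiff _ _ _
      _ ≤ ν C + ε := by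
        refine add_le_add ?_ ((hμ _).trans hγ)
        rw [Set.inter_eq_right.2 hLC, hL]
        exact measure_mono hLC
  have hclosed (C : Set X) (hC : IsClosed C) : α C = β C := by
    refine le_antisymm ?_ ?_ <;> refine ENNReal.le_of_forall_pos_le_add fun ε hε _ => ?_
    all_goals
      obtain ⟨L, hLC, hL, hlt⟩ := approx C hC ε (by simpa using hε.ne')
    · exact le_aux (γ := α + β) (Measure.le_add_right le_rfl) hLC hL hlt
    · exact le_aux (γ := α + β) (Measure.le_add_left le_rfl) hLC hL.symm hlt
  refine ext_of_generate_finite {C : Set X | IsClosed C} ?_ isPiSystem_isClosed hclosed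
    (hclosed _ isClosed_univ)
  rw [BorelSpace.measurable_eq (α := X), borel_eq_generateFrom_isClosed]

/-- Regular measures which agree on the traces of the members of a separating system off its cores
are equal. -/
theorem eq_of_system {R : ℕ → Set X} {U : ℕ → Set (Set X)} (hU : ∀ n, IsCoreFamily (R n) (U n))
    (hpi : IsPiSystem (⋃ n, offCore (R n, U n))) (huniv : Set.univ ∈ ⋃ n, offCore (R n, U n))
    (hsep : ∀ x y : X, x ≠ y → ∃ n, R n ∈ ⋃ n, offCore (R n, U n) ∧
        ∃ u ∈ U n, (x ∈ u ∧ y ∉ u) ∨ (x ∉ u ∧ y ∈ u))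
    {α β : Measure X} [IsFiniteMeasure α] [IsFiniteMeasure β] [α.Regular] [β.Regular]
    (h : ∀ n, ∀ V ∈ U n, α (V \ R n) = β (V \ R n)) : α = β := by
  have : (α + β).Regular := regular_add
  set 𝒟 := ⋃ n, offCore (R n, U n) with h𝒟
  have hD (A : Set X) (hA : A ∈ 𝒟) : α A = β A := by
    obtain ⟨n, V, hV, rfl⟩ := Set.mem_iUnion.1 hA
    exact h n V hV
  have hDm (A : Set X) (hA : A ∈ 𝒟) : MeasurableSet A := by
    obtain ⟨n, V, hV, rfl⟩ := Set.mem_iUnion.1 hA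
    exact ((hU n).isOpen_mem V hV).measurableSet.diff (hU n).isOpen_core.measurableSet
  -- Requiring `R n ∈ 𝒟` puts `V = (V \ R n) ∪ R n` in the generated σ-algebra. Members with null
  -- trace are discarded: off `Z` they contain no points beyond `R n`.
  let 𝒲 : Set (Set X) := (⋃ n, {V | R n ∈ 𝒟 ∧ V ∈ U n ∧ (α + β) (V \ R n) ≠ 0}) ∪
    {W | ∃ n, W = R n ∧ R n ∈ 𝒟}
  let Z : Set X := ⋃ n, ⋃₀ {V | V ∈ U n ∧ (α + β) (V \ R n) = 0} \ R n
  have hZ : MeasurableSet Z := MeasurableSet.iUnion fun n =>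
    (isOpen_sUnion fun V hV => (hU n).isOpen_mem V hV.1).measurableSet.diff
      (hU n).isOpen_core.measurableSet
  have hZ0 : (α + β) Z = 0 := measure_iUnion_null fun n =>
    measure_sUnion_sdiff_null (hU n).isOpen_core.measurableSet
      (fun V hV => (hU n).isOpen_mem V hV.1) fun V hV => hV.2
  rw [Measure.add_apply, add_eq_zero] at hZ0
  refine eq_of_countable_separating (𝒮 := 𝒟) (𝒲 := 𝒲)
    (fun A hA => ?_) ?_ ?_ ?_ hZ hZ0.1 hZ0.2 ?_
  · exact ext_on_measurableSpace_of_generate_finite _ 𝒟 hD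
      (MeasurableSpace.generateFrom_le hDm) rfl hpi (hD _ huniv) hA
  · refine Set.Countable.union (Set.countable_iUnion fun n => ?_)
      ((Set.countable_range R).mono ?_)
    · exact ((hU n).countable_ne_zero (α + β)).mono fun V hV => hV.2
    · rintro _ ⟨n, rfl, -⟩
      exact ⟨n, rfl⟩
  · rintro W (hW | ⟨n, rfl, -⟩)
    · obtain ⟨n, -, hV, -⟩ := Set.mem_iUnion.1 hW
      exact (hU n).isOpen_mem W hV
    · exact (hU n).isOpen_core
  · rintro W (hW | ⟨n, rfl, hR⟩)
    · obtain ⟨n, hR, hV, -⟩ := Set.mem_iUnion.1 hW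
      rw [← Set.sdiff_union_of_subset ((hU n).core_subset W hV)]
      have hW : W \ R n ∈ 𝒟 := Set.mem_iUnion.2 ⟨n, W, hV, rfl⟩
      exact (MeasurableSpace.measurableSet_generateFrom hW).union
        (MeasurableSpace.measurableSet_generateFrom hR)
    · exact MeasurableSpace.measurableSet_generateFrom hR
  · have aux (x y : X) (hx : x ∉ Z) (hW : ∀ W ∈ 𝒲, x ∈ W ↔ y ∈ W) (n : ℕ) (hR : R n ∈ 𝒟)
        (V : Set X) (hV : V ∈ U n) (hxV : x ∈ V) : y ∈ V := by
      by_cases h0 : (α + β) (V \ R n) = 0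
      · have hxR : x ∈ R n := by
          by_contra hxR
          exact hx (Set.mem_iUnion.2 ⟨n, ⟨V, ⟨hV, h0⟩, hxV⟩, hxR⟩)
        exact (hU n).core_subset V hV ((hW (R n) (Or.inr ⟨n, rfl, hR⟩)).1 hxR)
      · exact (hW V (Or.inl (Set.mem_iUnion.2 ⟨n, hR, hV, h0⟩))).1 hxV
    intro x hx y hy hW
    by_contra hne
    obtain ⟨n, hR, V, hV, ⟨h1, h2⟩ | ⟨h1, h2⟩⟩ := hsep x y hne
    · exact h2 (aux x y hx hW n hR V hV h1)
    · exact h1 (aux y x hy (fun W hW' => (hW W hW').symm) n hR V hV h2)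

end Uniqueness

/-! ### The norm of a system and its properties. -/

section GruenhageNorm

variable {K : Type*} [TopologicalSpace K] [CompactSpace K]

/-- The functions in the unit ball of `C(K)` supported on a set of the form `R ∪ ⋃ 𝓕` with
`𝓕 ⊆ U` of cardinality at most `m`. -/
def supportedBall (R : Set K) (U : Set (Set K)) (m : ℕ) : Set C(K, ℝ) :=
  {f | ‖f‖ ≤ 1 ∧ ∃ F : Finset (Set K), (F : Set (Set K)) ⊆ U ∧ F.card ≤ m ∧
    ∀ x ∉ R ∪ ⋃₀ (F : Set (Set K)), f x = 0}

theorem supportedBall_subset (R : Set K) (U : Set (Set K)) (m : ℕ) :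
    supportedBall R U m ⊆ Metric.closedBall 0 1 := fun f hf => by simpa using hf.1

theorem isLUB_supSeminorm_supportedBall (R : Set K) (U : Set (Set K)) (m : ℕ)
    (φ : StrongDual ℝ C(K, ℝ)) :
    IsLUB (φ '' supportedBall R U m) (supSeminorm (supportedBall R U m) φ) := by
  refine isLUB_supSeminorm (supportedBall_subset R U m) (fun f hf => ?_) ?_ φ
  · obtain ⟨h1, F, hF, hc, h0⟩ := hf
    exact ⟨by simpa using h1, F, hF, hc, fun x hx => by simp [h0 x hx]⟩
  · exact ⟨by simp, ∅, by simp, by simp, fun x _ => rfl⟩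

/-- The balls whose support seminorms constitute the norm. -/
def systemBall (R : ℕ → Set K) (U : ℕ → Set (Set K)) : Unit ⊕ (ℕ × ℕ) → Set C(K, ℝ) :=
  Sum.elim (fun _ => Metric.closedBall 0 1) fun p => supportedBall (R p.2) (U p.2) p.1

/-- The weights of the seminorms that constitute the norm. -/
noncomputable def systemWeight : Unit ⊕ (ℕ × ℕ) → ℝ :=
  Sum.elim (fun _ => 1) fun p => (1 / 2 : ℝ) ^ (p.1 + p.2)

theorem systemWeight_pos (i : Unit ⊕ (ℕ × ℕ)) : 0 < systemWeight i := by
  rcases i with _ | p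
  · exact zero_lt_one
  · exact pow_pos (by norm_num) _

theorem summable_systemWeight_inr : Summable fun p : ℕ × ℕ => (1 / 2 : ℝ) ^ (p.1 + p.2) := by
  simp_rw [pow_add]
  exact summable_geometric_two.mul_of_nonneg summable_geometric_two
    (fun n => by positivity) (fun n => by positivity)

theorem summable_systemWeight : Summable systemWeight :=
  (HasSum.sum (f := systemWeight) (hasSum_unique _) summable_systemWeight_inr.hasSum).summable

variable {R : ℕ → Set K} {U : ℕ → Set (Set K)}

theorem systemBall_subset (i : Unit ⊕ (ℕ × ℕ)) : systemBall R U i ⊆ Metric.closedBall 0 1 := by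
  rcases i with _ | p
  · exact subset_rfl
  · exact supportedBall_subset _ _ _

theorem isLUB_supSeminorm_systemBall (i : Unit ⊕ (ℕ × ℕ)) (φ : StrongDual ℝ C(K, ℝ)) :
    IsLUB (φ '' systemBall R U i) (supSeminorm (systemBall R U i) φ) := by
  rcases i with _ | p
  · exact isLUB_supSeminorm subset_rfl (by simp) (by simp) φ
  · exact isLUB_supSeminorm_supportedBall _ _ _ φ

theorem summable_supSeminorm_systemBall (φ : StrongDual ℝ C(K, ℝ)) :
    Summable fun i => systemWeight i * supSeminorm (systemBall R U i) φ ^ 2 := by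
  refine .of_nonneg_of_le (fun i => mul_nonneg (systemWeight_pos i).le (sq_nonneg _))
    (fun i => ?_) (summable_systemWeight.mul_right (‖φ‖ ^ 2))
  exact mul_le_mul_of_nonneg_left (pow_le_pow_left₀ (apply_nonneg _ _)
    (supSeminorm_le_norm (systemBall_subset i) φ) 2) (systemWeight_pos i).le

/-- The square root of `‖φ‖² + ∑ 2⁻ᵐ⁻ⁿ ‖φ‖ₘₙ²`. -/
noncomputable def systemNorm (R : ℕ → Set K) (U : ℕ → Set (Set K)) :
    Seminorm ℝ (StrongDual ℝ C(K, ℝ)) :=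
  ellTwoSeminorm systemWeight (fun i => supSeminorm (systemBall R U i))
    (fun i => (systemWeight_pos i).le) summable_supSeminorm_systemBall

theorem hasSum_systemNorm_sq (φ : StrongDual ℝ C(K, ℝ)) :
    HasSum (fun p : ℕ × ℕ => (1 / 2 : ℝ) ^ (p.1 + p.2) *
      supSeminorm (supportedBall (R p.2) (U p.2) p.1) φ ^ 2) (systemNorm R U φ ^ 2 - ‖φ‖ ^ 2) := by
  have h := summable_supSeminorm_systemBall (R := R) (U := U) φ
  have hr := (h.comp_injective Sum.inr_injective).hasSum
  have hl : HasSum ((fun i => systemWeight i * supSeminorm (systemBall R U i) φ ^ 2) ∘ Sum.inl)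
      (‖φ‖ ^ 2) := by
    convert hasSum_unique (β := Unit) _ using 1
    change _ = 1 * supSeminorm (Metric.closedBall 0 1) φ ^ 2
    rw [supSeminorm_closedBall, one_mul]
  have hsum : systemNorm R U φ ^ 2 = _ := (ellTwoSeminorm_sq φ).trans (hl.sum hr).tsum_eq
  rw [hsum, add_sub_cancel_left]
  exact hr

theorem isEquivalentNorm_systemNorm :
    IsEquivalentNorm (E := StrongDual ℝ C(K, ℝ)) (systemNorm R U) := by
  set T := ∑' i, systemWeight i with hT
  have hT0 : 0 ≤ T := tsum_nonneg fun i => (systemWeight_pos i).le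
  -- The constant `√T` already bounds the norm; the added `1` only secures positivity.
  refine ⟨1, √T + 1, one_pos, by positivity, fun φ => ⟨?_, ?_⟩⟩
  · rw [one_mul]
    refine abs_le_of_sq_le_sq' ?_ (apply_nonneg _ _) |>.2
    have := (hasSum_systemNorm_sq (R := R) (U := U) φ).nonneg fun p => by positivity
    linarith
  · refine (Real.sqrt_le_sqrt ((summable_supSeminorm_systemBall φ).tsum_le_tsum
      (g := fun i => systemWeight i * ‖φ‖ ^ 2) (fun i => ?_)
      (summable_systemWeight.mul_right _))).trans ?_
    · exact mul_le_mul_of_nonneg_left (pow_le_pow_left₀ (apply_nonneg _ _)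
        (supSeminorm_le_norm (systemBall_subset i) φ) 2) (systemWeight_pos i).le
    · rw [tsum_mul_right, Real.sqrt_mul hT0, Real.sqrt_sq (norm_nonneg φ)]
      gcongr
      linarith

theorem isDualNorm_systemNorm : IsDualNorm (systemNorm R U) :=
  isDualNorm_of_exists_lt isEquivalentNorm_systemNorm
    (exists_lt_of_lt_ellTwoSeminorm isLUB_supSeminorm_systemBall)

variable [T2Space K] [MeasurableSpace K] [BorelSpace K]

/-- Both sides are iterated suprema over `F` and over functions supported on `R ∪ ⋃₀ F`, by
`RepresentedBy.isLUB_isOpen`. -/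
theorem isSupSeminorm_supportedBall {R : Set K} {U : Set (Set K)} (hR : IsOpen R)
    (hU : ∀ u ∈ U, IsOpen u) (m : ℕ) :
    IsSupSeminorm R U m (supSeminorm (supportedBall R U m)) := by
  intro φ μ hφ
  have hlub (F : Finset (Set K)) (hF : (F : Set (Set K)) ⊆ U) :=
    hφ.isLUB_isOpen (hR.union (isOpen_sUnion fun u hu => hU u (hF hu)))
  have hS := isLUB_supSeminorm_supportedBall R U m φ
  constructor
  · rintro _ ⟨F, hF, hcard, rfl⟩
    refine (hlub F hF).2 ?_
    rintro _ ⟨f, ⟨hf, h0⟩, rfl⟩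
    exact hS.1 ⟨f, ⟨hf, F, hF, hcard, h0⟩, rfl⟩
  · intro b hb
    refine hS.2 ?_
    rintro _ ⟨f, ⟨hf, F, hF, hcard, h0⟩, rfl⟩
    exact ((hlub F hF).1 ⟨f, ⟨hf, h0⟩, rfl⟩).trans (hb ⟨F, hF, hcard, rfl⟩)

theorem isLatticeNorm_systemNorm (hU : ∀ n, IsCoreFamily (R n) (U n)) :
    IsLatticeNorm (systemNorm R U) := by
  intro φ ψ μ ν hφ hψ hle
  have hreal (A : Set K) : μ.totalVariation.real A ≤ ν.totalVariation.real A :=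
    ENNReal.toReal_mono (measure_ne_top _ _) (hle A)
  refine ellTwoSeminorm_mono fun i => ?_
  rcases i with _ | p
  · change supSeminorm (Metric.closedBall 0 1) φ ≤ supSeminorm (Metric.closedBall 0 1) ψ
    rw [supSeminorm_closedBall, supSeminorm_closedBall, hφ.norm_eq, hψ.norm_eq]
    exact hreal _
  · have hsup := isSupSeminorm_supportedBall (hU p.2).isOpen_core (hU p.2).isOpen_mem p.1
    refine (hsup φ μ hφ).2 ?_
    rintro _ ⟨F, hF, hcard, rfl⟩
    exact (hreal _).trans ((hsup ψ ν hψ).1 ⟨F, hF, hcard, rfl⟩)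

theorem isStrictlyConvexNorm_systemNorm (hU : ∀ n, IsCoreFamily (R n) (U n))
    (hpi : IsPiSystem (⋃ n, offCore (R n, U n))) (huniv : Set.univ ∈ ⋃ n, offCore (R n, U n))
    (hsep : ∀ x y : K, x ≠ y → ∃ n, R n ∈ ⋃ n, offCore (R n, U n) ∧
        ∃ u ∈ U n, (x ∈ u ∧ y ∉ u) ∨ (x ∉ u ∧ y ∈ u)) :
    IsStrictlyConvexNorm (systemNorm R U) := by
  intro φ ψ h₁ h₂
  have hq (i) := eq_of_ellTwoSeminorm_eq h₁ h₂ (systemWeight_pos i)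
  obtain ⟨μ, hμ⟩ := exists_representedBy φ
  obtain ⟨ν, hν⟩ := exists_representedBy ψ
  have hμν := hμ.add hν
  have := hμ.1
  have := hν.1
  have hadd : (μ + ν).totalVariation = μ.totalVariation + ν.totalVariation := by
    -- One inequality always holds between these finite measures, so equal total masses, that is
    -- additivity of `‖·‖₁`, suffice.
    refine Measure.eq_of_le_of_measure_univ_eq (totalVariation_add_le μ ν) ?_
    have h := (hq (Sum.inl ())).2
    change supSeminorm (Metric.closedBall 0 1) (φ + ψ) = supSeminorm (Metric.closedBall 0 1) φ +
      supSeminorm (Metric.closedBall 0 1) ψ at h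
    rw [supSeminorm_closedBall, supSeminorm_closedBall, supSeminorm_closedBall, hμ.norm_eq,
      hν.norm_eq, hμν.norm_eq, ← measureReal_add_apply] at h
    exact (ENNReal.toReal_eq_toReal_iff' (measure_ne_top _ _) (measure_ne_top _ _)).1 h
  have heq : μ.totalVariation = ν.totalVariation := by
    refine eq_of_system hU hpi huniv hsep fun n V hV => ?_
    have hsup (m) := isSupSeminorm_supportedBall (hU n).isOpen_core (hU n).isOpen_mem m
    have hqn (m) : supSeminorm (supportedBall (R n) (U n) m) φ =
        supSeminorm (supportedBall (R n) (U n) m) ψ ∧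
        supSeminorm (supportedBall (R n) (U n) m) (φ + ψ) =
        supSeminorm (supportedBall (R n) (U n) m) φ +
        supSeminorm (supportedBall (R n) (U n) m) ψ := hq (Sum.inr (m, n))
    have h := (hU n).measureReal_sdiff_eq (α := μ.totalVariation) (β := ν.totalVariation)
      (t := fun m => supSeminorm (supportedBall (R n) (U n) m) φ)
      (fun m F hF hcard => (hsup m φ μ hμ).1 ⟨F, hF, hcard, rfl⟩)
      (fun m F hF hcard => (hqn m).1 ▸ (hsup m ψ ν hν).1 ⟨F, hF, hcard, rfl⟩)
      (fun m => by
        have := hsup m (φ + ψ) (μ + ν) hμν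
        rwa [hadd, (hqn m).2, ← (hqn m).1] at this) hV
    exact (ENNReal.toReal_eq_toReal_iff' (measure_ne_top _ _) (measure_ne_top _ _)).1 h
  obtain rfl := eq_of_totalVariation_add heq hadd
  exact hμ.unique hν

end GruenhageNorm

theorem theorem5p5 {K : Type*} [TopologicalSpace K] [CompactSpace K] [T2Space K]
    [MeasurableSpace K] [BorelSpace K] (hK : IsGruenhage K) :
    ∃ N : Seminorm ℝ (StrongDual ℝ C(K, ℝ)),
      IsEquivalentNorm (E := StrongDual ℝ C(K, ℝ)) N ∧ IsDualNorm N ∧ IsLatticeNorm N ∧ IsStrictlyConvexNorm N ∧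
      ∃ (R : ℕ → Set K) (U : ℕ → Set (Set K)) (S : ℕ → ℕ → Seminorm ℝ (StrongDual ℝ C(K, ℝ))),
        IsGruenhageSystem R U ∧
        (∀ m n, IsSupSeminorm (R n) (U n) m (S m n) ∧ IsWeakStarLSC (S m n)) ∧
        ∀ φ, Summable (fun p : ℕ × ℕ => (1 / 2 : ℝ) ^ (p.1 + p.2) * S p.1 p.2 φ ^ 2) ∧
          N φ ^ 2 = ‖φ‖ ^ 2 +
            ∑' p : ℕ × ℕ, (1 / 2 : ℝ) ^ (p.1 + p.2) * S p.1 p.2 φ ^ 2 := by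
  obtain ⟨R, U, hU, hpi, huniv, hsep⟩ := hK.exists_system
  refine ⟨systemNorm R U, isEquivalentNorm_systemNorm, isDualNorm_systemNorm,
    isLatticeNorm_systemNorm hU, isStrictlyConvexNorm_systemNorm hU hpi huniv hsep, R, U,
    fun m n => supSeminorm (supportedBall (R n) (U n) m),
    ⟨fun n => (hU n).isOpen_core, fun n => (hU n).isOpen_mem, fun n => (hU n).core_subset,
      fun n => (hU n).inter_eq, fun x y hxy => ?_⟩,
    fun m n => ⟨isSupSeminorm_supportedBall (hU n).isOpen_core (hU n).isOpen_mem m,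
      isWeakStarLSC_supSeminorm (supportedBall_subset _ _ _)⟩, fun φ => ?_⟩
  · obtain ⟨n, -, h⟩ := hsep x y hxy
    exact ⟨n, h⟩
  · have h := hasSum_systemNorm_sq (R := R) (U := U) φ
    exact ⟨h.summable, by rw [h.tsum_eq, add_sub_cancel]⟩
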